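/- Let $\mathbb K\in\{\mathbb R,\mathbb C\}$ and let $X$ be a Banach space over $\mathbb K$ that fails the approximation property, i.e. it is not true that for every compact $K\subset X$ and every $\varepsilon>0$ there is a bounded finite rank operator $T$ on $X$ with $\sup_{x\in K}\|x-Tx\|\le\varepsilon$. For a sequence $x=(x_n)$ in $X$ write $\Gamma(x)=\overline{\mathrm{conv}}\{c\,x_n : n\in\mathbb N,\ c\in\mathbb K,\ |c|=1\}$ (so $\Gamma(x)=\overline{\mathrm{conv}}\{\pm x_n: n\in\mathbb N\}$ for real scalars). Call $x$ admissible if $0<\|x_n\|\le 1$ for all $n$, $\|x_n\|\to0$, and there is $c>0$ such that $\sup_{y\in\Gamma(x)}\|y-Vy\|\ge c$ for every bounded finite rank operator $V$ on $X$. Given an admissible sequence $x$ and $t\in(0,1)$, let $U_t=\Gamma\big((x_n/\|x_n\|^{t})_n\big)$, let $Y_t$ be the linear span of $U_t$ in $X$, and let $|y|_t=\inf\{\lambda>0: y\in\lambda U_t\}$ for $y\in Y_t$. Let $\mathcal Z$ be the linear span of the functions $y\chi_{(s,t)}$ on $(0,1)$ with $0<s<t<1$ and $y\in Y_s$, with $$\|f\|=\int_0^1|f(r)|_r\,dr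 ,\qquad f\in\mathcal Z$$ (functions that agree almost everywhere are identified), and let the Willis space $Z=Z_X$ be the completion of $(\mathcal Z,\|\cdot\|)$. Let $\mathcal K(Z)$ be the space of compact operators on $Z$ with the operator norm, let $\mathcal A(Z)$ be the norm closure of the bounded finite rank operators on $Z$, and give $\mathcal K(Z)/\mathcal A(Z)$ the quotient norm. Then admissible sequences in $X$ exist, and for every admissible sequence there is a linear isomorphic embedding $\psi:c_0\to\mathcal K(Z)/\mathcal A(Z)$, that is, a bounded linear map for which there is $\delta>0$ with $\|\psi(a)\|\ge\delta\|a\|$ for all $a\in c_0$. -/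

import Mathlib

open Set Filter Topology MeasureTheory
open scoped Pointwise ZeroAtInfty

section Operators

variable (𝕜 : Type*) [RCLike 𝕜]

/-- The linear space `F(X)` of bounded finite rank operators on `X`. -/
def finiteRankOperators (X : Type*) [NormedAddCommGroup X] [NormedSpace 𝕜 X] :
    Submodule 𝕜 (X →L[𝕜] X) where
  carrier := {T | FiniteDimensional 𝕜 (LinearMap.range (T : X →ₗ[𝕜] X))}
  add_mem' {S T} hS hT := by
    have hS' : FiniteDimensional 𝕜 (LinearMap.range (S : X →ₗ[𝕜] X)) := hS
    have hT' : FiniteDimensional 𝕜 (LinearMap.range (T : X →ₗ[𝕜] X)) := hT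
    refine Submodule.finiteDimensional_of_le
      (S₂ := LinearMap.range (S : X →ₗ[𝕜] X) ⊔ LinearMap.range (T : X →ₗ[𝕜] X)) ?_
    rintro _ ⟨x, rfl⟩
    exact Submodule.add_mem_sup ⟨x, rfl⟩ ⟨x, rfl⟩
  zero_mem' := by
    refine Submodule.finiteDimensional_of_le (S₂ := (⊥ : Submodule 𝕜 X)) ?_
    rintro _ ⟨x, rfl⟩
    simp
  smul_mem' c T hT := by
    have hT' : FiniteDimensional 𝕜 (LinearMap.range (T : X →ₗ[𝕜] X)) := hT
    refine Submodule.finiteDimensional_of_le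
      (S₂ := LinearMap.range (T : X →ₗ[𝕜] X)) ?_
    rintro _ ⟨x, rfl⟩
    exact Submodule.smul_mem _ c ⟨x, rfl⟩

/-- The approximation property. -/
def HasApproximationProperty (X : Type*) [NormedAddCommGroup X] [NormedSpace 𝕜 X] : Prop :=
  ∀ K : Set X, IsCompact K → ∀ ε : ℝ, 0 < ε →
    ∃ T ∈ finiteRankOperators 𝕜 X, ∀ x ∈ K, ‖x - T x‖ ≤ ε

/-- The Banach space `K(X)` of compact operators on `X`, with the operator norm. -/
abbrev CompactOperators (X : Type*) [NormedAddCommGroup X] [NormedSpace 𝕜 X] :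
    Submodule 𝕜 (X →L[𝕜] X) :=
  compactOperator (RingHom.id 𝕜) X X

/-- The space `A(X)` of approximable operators: the norm closure of `F(X)`. -/
def approximableOperators (X : Type*) [NormedAddCommGroup X] [NormedSpace 𝕜 X] :
    Submodule 𝕜 (X →L[𝕜] X) :=
  (finiteRankOperators 𝕜 X).topologicalClosure

/-- The subspace `A(X)` of `K(X)`. -/
def approximableInCompact (X : Type*) [NormedAddCommGroup X] [NormedSpace 𝕜 X] :
    Submodule 𝕜 (CompactOperators 𝕜 X) :=
  (approximableOperators 𝕜 X).comap (CompactOperators 𝕜 X).subtype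

instance isClosed_approximableInCompact (X : Type*) [NormedAddCommGroup X] [NormedSpace 𝕜 X] :
    IsClosed (approximableInCompact 𝕜 X : Set (CompactOperators 𝕜 X)) :=
  (Submodule.isClosed_topologicalClosure (finiteRankOperators 𝕜 X)).preimage
    continuous_subtype_val

/-- The quotient `K(X) / A(X)`. -/
def CompactByApproximable (X : Type*) [NormedAddCommGroup X] [NormedSpace 𝕜 X] : Type _ :=
  CompactOperators 𝕜 X ⧸ approximableInCompact 𝕜 X

/-- The quotient norm `‖T + A(X)‖ = inf {‖T - S‖ : S ∈ A(X)}`. -/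
noncomputable instance (X : Type*) [NormedAddCommGroup X] [NormedSpace 𝕜 X] :
    NormedAddCommGroup (CompactByApproximable 𝕜 X) :=
  inferInstanceAs (NormedAddCommGroup (CompactOperators 𝕜 X ⧸ approximableInCompact 𝕜 X))

noncomputable instance (X : Type*) [NormedAddCommGroup X] [NormedSpace 𝕜 X] :
    NormedSpace 𝕜 (CompactByApproximable 𝕜 X) :=
  inferInstanceAs (NormedSpace 𝕜 (CompactOperators 𝕜 X ⧸ approximableInCompact 𝕜 X))

end Operators

section Gauge

variable {𝕜 X : Type*} [RCLike 𝕜] [NormedAddCommGroup X] [NormedSpace 𝕜 X]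
  [NormedSpace ℝ X]

/-- The closed convex hull of `{c x_n : n ∈ ℕ, |c| = 1}`; over the reals this is the closed
convex hull of `{± x_n : n ∈ ℕ}`. -/
def closedCircledHull (𝕜 : Type*) {X : Type*} [RCLike 𝕜] [NormedAddCommGroup X]
    [NormedSpace 𝕜 X] [NormedSpace ℝ X] (x : ℕ → X) : Set X :=
  closure (convexHull ℝ {z | ∃ (n : ℕ) (c : 𝕜), ‖c‖ = 1 ∧ z = c • x n})

theorem mem_closedCircledHull (x : ℕ → X) (n : ℕ) : x n ∈ closedCircledHull 𝕜 x :=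
  subset_closure (subset_convexHull ℝ _ ⟨n, 1, by simp, by simp⟩)

theorem convex_closedCircledHull (x : ℕ → X) : Convex ℝ (closedCircledHull 𝕜 x) :=
  (convex_convexHull ℝ _).closure

variable [IsScalarTower ℝ 𝕜 X]

theorem balanced_closedCircledHull (x : ℕ → X) : Balanced 𝕜 (closedCircledHull 𝕜 x) := by
  set S : Set X := {z | ∃ (n : ℕ) (c : 𝕜), ‖c‖ = 1 ∧ z = c • x n} with hS
  have h0 : (0 : X) ∈ convexHull ℝ S := by
    have h1 : x 0 ∈ convexHull ℝ S := subset_convexHull ℝ _ ⟨0, 1, by simp, by simp⟩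
    have h2 : -x 0 ∈ convexHull ℝ S := subset_convexHull ℝ _ ⟨0, -1, by simp, by simp⟩
    have h3 := convex_convexHull ℝ S h1 h2 (a := 1 / 2) (b := 1 / 2)
      (by norm_num) (by norm_num) (by norm_num)
    simpa using h3
  have hunit : ∀ u : 𝕜, ‖u‖ = 1 → ∀ z ∈ convexHull ℝ S, u • z ∈ convexHull ℝ S := by
    intro u hu z hz
    let L : X →ₗ[ℝ] X :=
      { toFun := fun y => u • y
        map_add' := fun a b => smul_add u a b
        map_smul' := fun r y => by
          simp only [RingHom.id_apply]
          rw [← algebraMap_smul 𝕜 r y, ← algebraMap_smul 𝕜 r (u • y), smul_comm] }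
    have hsub : L '' S ⊆ S := by
      rintro _ ⟨_, ⟨n, c, hc, rfl⟩, rfl⟩
      exact ⟨n, u * c, by simp [hu, hc], by simp [L, mul_smul]⟩
    have h1 : L z ∈ convexHull ℝ (L '' S) := by
      rw [← L.image_convexHull]
      exact ⟨z, hz, rfl⟩
    exact convexHull_mono hsub h1
  refine Balanced.closure (balanced_iff_smul_mem.2 ?_)
  intro a ha z hz
  by_cases ha0 : a = 0
  · simpa [ha0] using h0
  have hna : (0 : ℝ) < ‖a‖ := norm_pos_iff.2 ha0
  have h1 : ((‖a‖⁻¹ : ℝ) : 𝕜) • a • z ∈ convexHull ℝ S := by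
    rw [smul_smul]
    refine hunit _ ?_ z hz
    rw [norm_mul, RCLike.norm_ofReal, abs_of_pos (inv_pos.2 hna), inv_mul_cancel₀ hna.ne']
  have h2 := (convex_convexHull ℝ S).smul_mem_of_zero_mem h0 h1 ⟨hna.le, ha⟩
  have h3 : ‖a‖ • ((‖a‖⁻¹ : ℝ) : 𝕜) • a • z = a • z := by
    rw [← algebraMap_smul 𝕜 ‖a‖, smul_smul, RCLike.algebraMap_eq_ofReal, ← RCLike.ofReal_mul,
      mul_inv_cancel₀ hna.ne', RCLike.ofReal_one, one_smul]
  rwa [h3] at h2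

/-- On the linear span of a nonempty balanced convex set the Minkowski functional is finite. -/
theorem exists_mem_smul_of_mem_span {U : Set X} (hc : Convex ℝ U) (hb : Balanced 𝕜 U)
    (hne : U.Nonempty) {y : X} (hy : y ∈ Submodule.span 𝕜 U) :
    ∃ r : ℝ, 0 < r ∧ y ∈ r • U := by
  have h0 : (0 : X) ∈ U := hb.zero_mem hne
  induction hy using Submodule.span_induction with
  | mem z hz => exact ⟨1, one_pos, by simpa using hz⟩
  | zero => exact ⟨1, one_pos, by simpa using h0⟩
  | add a b _ _ iha ihb =>
    obtain ⟨r, hr, ha⟩ := iha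
    obtain ⟨q, hq, hb'⟩ := ihb
    exact ⟨r + q, by positivity, by
      rw [hc.add_smul hr.le hq.le]
      exact Set.add_mem_add ha hb'⟩
  | smul c a _ iha =>
    obtain ⟨r, hr, z, hz, rfl⟩ := iha
    refine ⟨r * (‖c‖ + 1), by positivity, (((‖c‖ + 1)⁻¹ : ℝ) : 𝕜) • c • z, ?_, ?_⟩
    · rw [smul_smul]
      refine hb.smul_mem ?_ hz
      rw [norm_mul, RCLike.norm_ofReal, abs_of_pos (by positivity), inv_mul_le_one₀ (by positivity)]
      linarith
    · have hpos : (‖c‖ + 1 : ℝ) ≠ 0 := by positivity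
      change (r * (‖c‖ + 1)) • (((‖c‖ + 1)⁻¹ : ℝ) : 𝕜) • c • z = c • r • z
      rw [← algebraMap_smul 𝕜 (r * (‖c‖ + 1)), ← algebraMap_smul 𝕜 r, smul_smul, smul_comm c,
        RCLike.algebraMap_eq_ofReal, ← RCLike.ofReal_mul, mul_assoc, mul_inv_cancel₀ hpos, mul_one]

theorem gauge_add_le_of_mem_span {U : Set X} (hc : Convex ℝ U) (hb : Balanced 𝕜 U)
    (hne : U.Nonempty) {y z : X} (hy : y ∈ Submodule.span 𝕜 U) (hz : z ∈ Submodule.span 𝕜 U) :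
    gauge U (y + z) ≤ gauge U y + gauge U z := by
  refine le_of_forall_pos_lt_add fun ε hε => ?_
  obtain ⟨r, ⟨hr, hyr⟩, hr'⟩ := exists_lt_of_csInf_lt
    (show {r ∈ Ioi (0 : ℝ) | y ∈ r • U}.Nonempty from exists_mem_smul_of_mem_span hc hb hne hy)
    (show gauge U y < gauge U y + ε / 2 by linarith)
  obtain ⟨q, ⟨hq, hzq⟩, hq'⟩ := exists_lt_of_csInf_lt
    (show {r ∈ Ioi (0 : ℝ) | z ∈ r • U}.Nonempty from exists_mem_smul_of_mem_span hc hb hne hz)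
    (show gauge U z < gauge U z + ε / 2 by linarith)
  have hr0 : 0 ≤ r := le_of_lt hr
  have hq0 : 0 ≤ q := le_of_lt hq
  have h : gauge U (y + z) ≤ r + q := by
    refine gauge_le_of_mem (add_nonneg hr0 hq0) ?_
    rw [hc.add_smul hr0 hq0]
    exact Set.add_mem_add hyr hzq
  linarith

end Gauge

/-- The data on which the construction of the Willis space rests: a null sequence of nonzero
vectors in the unit ball of `X` such that on the set `K`, the closed convex hull of
`{c x_n : n ∈ ℕ, |c| = 1}`, the identity of `X` is not a uniform limit of finite rank
operators. -/
structure WillisSequence (𝕜 X : Type*) [RCLike 𝕜] [NormedAddCommGroup X] [NormedSpace 𝕜 X]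
    [NormedSpace ℝ X] where
  x : ℕ → X
  norm_pos : ∀ n, 0 < ‖x n‖
  norm_le_one : ∀ n, ‖x n‖ ≤ 1
  tendsto_norm : Tendsto (fun n => ‖x n‖) atTop (𝓝 0)
  fails : ∃ c : ℝ, 0 < c ∧ ∀ V ∈ finiteRankOperators 𝕜 X,
    ∃ y ∈ closedCircledHull 𝕜 x, c ≤ ‖y - V y‖

namespace WillisSequence

variable {𝕜 X : Type*} [RCLike 𝕜] [NormedAddCommGroup X] [NormedSpace 𝕜 X]
  [NormedSpace ℝ X] (w : WillisSequence 𝕜 X)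

/-- The set `U_t`: the closed convex hull of the vectors `c x_n / ‖x_n‖ ^ t` with `|c| = 1`. -/
def U (t : ℝ) : Set X := closedCircledHull 𝕜 fun n => (‖w.x n‖ ^ t)⁻¹ • w.x n

/-- The space `Y_t`: the linear span of `U_t` in `X`. -/
def Y (t : ℝ) : Submodule 𝕜 X := Submodule.span 𝕜 (w.U t)

/-- The norm `|·|_t` of `Y_t`: the Minkowski functional of `U_t`. -/
noncomputable def normY (t : ℝ) (y : X) : ℝ := gauge (w.U t) y

/-- The linear span of the functions `y χ_(s,t)` with `0 < s < t < 1` and `y ∈ Y_s`. -/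
def simpleFunctions : Submodule 𝕜 (ℝ → X) :=
  Submodule.span 𝕜 {f | ∃ s t : ℝ, 0 < s ∧ s < t ∧ t < 1 ∧
    ∃ y ∈ w.Y s, f = (Ioo s t).indicator fun _ => y}

/-- The space of simple functions as a type of its own: it is not to carry the topology of
pointwise convergence. -/
def Simple : Type _ := w.simpleFunctions

instance : AddCommGroup w.Simple := inferInstanceAs (AddCommGroup w.simpleFunctions)

instance : Module 𝕜 w.Simple := inferInstanceAs (Module 𝕜 w.simpleFunctions)

/-- The simple function, extended by zero outside `(0, 1)`, that an element of `w.Simple` is. -/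
def eval (f : w.Simple) : ℝ → X := (show w.simpleFunctions from f).1

theorem convex_U (t : ℝ) : Convex ℝ (w.U t) := convex_closedCircledHull _

theorem nonempty_U (t : ℝ) : (w.U t).Nonempty := ⟨_, mem_closedCircledHull _ 0⟩

section

variable [IsScalarTower ℝ 𝕜 X]

theorem balanced_U (t : ℝ) : Balanced 𝕜 (w.U t) := balanced_closedCircledHull _

theorem U_mono {s t : ℝ} (hst : s ≤ t) : w.U s ⊆ w.U t := by
  refine closure_minimal (convexHull_min ?_ (w.convex_U t)) isClosed_closure
  rintro _ ⟨n, c, hc, rfl⟩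
  refine (w.balanced_U t).smul_mem hc.le ?_
  have hp := w.norm_pos n
  have h1 : (‖w.x n‖ ^ s)⁻¹ = ‖w.x n‖ ^ (t - s) * (‖w.x n‖ ^ t)⁻¹ := by
    rw [← Real.rpow_neg hp.le, ← Real.rpow_neg hp.le, ← Real.rpow_add hp]
    congr 1
    ring
  have h2 : ‖w.x n‖ ^ (t - s) ≤ 1 :=
    Real.rpow_le_one hp.le (w.norm_le_one n) (sub_nonneg.2 hst)
  change (‖w.x n‖ ^ s)⁻¹ • w.x n ∈ w.U t
  rw [h1, mul_smul]
  exact (w.convex_U t).smul_mem_of_zero_mem ((w.balanced_U t).zero_mem (w.nonempty_U t))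
    (mem_closedCircledHull _ n) ⟨by positivity, h2⟩

theorem Y_mono {s t : ℝ} (hst : s ≤ t) : w.Y s ≤ w.Y t := Submodule.span_mono (w.U_mono hst)

theorem normY_anti {s t : ℝ} (hst : s ≤ t) {y : X} (hy : y ∈ w.Y s) :
    w.normY t y ≤ w.normY s y :=
  csInf_le_csInf ⟨0, fun _ h => le_of_lt h.1⟩
    (exists_mem_smul_of_mem_span (w.convex_U s) (w.balanced_U s) (w.nonempty_U s) hy)
    fun _ h => ⟨h.1, smul_set_mono (w.U_mono hst) h.2⟩

theorem normY_add_le {t : ℝ} {y z : X} (hy : y ∈ w.Y t) (hz : z ∈ w.Y t) :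
    w.normY t (y + z) ≤ w.normY t y + w.normY t z :=
  gauge_add_le_of_mem_span (w.convex_U t) (w.balanced_U t) (w.nonempty_U t) hy hz

theorem normY_smul (t : ℝ) (c : 𝕜) (y : X) : w.normY t (c • y) = ‖c‖ * w.normY t y :=
  gauge_smul (w.balanced_U t) c y

/-- A simple function takes values in the spaces `Y_r`, with uniformly bounded norms. -/
theorem simple_bounded (f : w.Simple) :
    ∃ C : ℝ, ∀ r, w.eval f r ∈ w.Y r ∧ w.normY r (w.eval f r) ≤ C := by
  obtain ⟨f, hf⟩ := f
  change ∃ C : ℝ, ∀ r, f r ∈ w.Y r ∧ w.normY r (f r) ≤ C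
  have h0 : ∀ r, w.normY r 0 = 0 := fun r => gauge_zero
  induction hf using Submodule.span_induction with
  | mem f hf =>
    obtain ⟨s, t, -, -, -, y, hy, rfl⟩ := hf
    refine ⟨w.normY s y, fun r => ?_⟩
    by_cases hr : r ∈ Ioo s t
    · rw [indicator_of_mem hr]
      exact ⟨w.Y_mono hr.1.le hy, w.normY_anti hr.1.le hy⟩
    · rw [indicator_of_notMem hr]
      exact ⟨zero_mem _, (h0 r).le.trans (gauge_nonneg _)⟩
  | zero => exact ⟨0, fun r => ⟨zero_mem _, (h0 r).le⟩⟩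
  | add f g _ _ hf hg =>
    obtain ⟨C, hC⟩ := hf
    obtain ⟨D, hD⟩ := hg
    exact ⟨C + D, fun r => ⟨add_mem (hC r).1 (hD r).1,
      (w.normY_add_le (hC r).1 (hD r).1).trans (add_le_add (hC r).2 (hD r).2)⟩⟩
  | smul c f _ hf =>
    obtain ⟨C, hC⟩ := hf
    refine ⟨‖c‖ * C, fun r => ⟨Submodule.smul_mem _ c (hC r).1, ?_⟩⟩
    rw [Pi.smul_apply, w.normY_smul]
    exact mul_le_mul_of_nonneg_left (hC r).2 (norm_nonneg c)

/-- The function `r ↦ |f(r)|_r` is integrable on `(0, 1)`. -/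
theorem simple_integrable (f : w.Simple) :
    IntegrableOn (fun r => w.normY r (w.eval f r)) (Ioo 0 1) := by
  obtain ⟨C, hC⟩ := w.simple_bounded f
  have hφ : ∃ φ : SimpleFunc ℝ X, ⇑φ = w.eval f := by
    obtain ⟨f, hf⟩ := f
    change ∃ φ : SimpleFunc ℝ X, ⇑φ = f
    clear hC
    induction hf using Submodule.span_induction with
    | mem f hf =>
      obtain ⟨s, t, -, -, -, y, -, rfl⟩ := hf
      classical
      refine ⟨SimpleFunc.piecewise (Ioo s t) measurableSet_Ioo (SimpleFunc.const ℝ y)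
        (SimpleFunc.const ℝ 0), ?_⟩
      ext r
      by_cases hr : r ∈ Ioo s t <;> simp [hr]
    | zero => exact ⟨0, rfl⟩
    | add f g _ _ hf hg =>
      obtain ⟨φ, rfl⟩ := hf
      obtain ⟨ψ, rfl⟩ := hg
      exact ⟨φ + ψ, rfl⟩
    | smul c f _ hf =>
      obtain ⟨φ, rfl⟩ := hf
      exact ⟨c • φ, rfl⟩
  obtain ⟨φ, hφ⟩ := hφ
  have hm : AEMeasurable (fun r => w.normY r (w.eval f r)) volume := by
    have hU : (⋃ v : φ.range, φ ⁻¹' {(v : X)}) = univ := by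
      ext r
      simp
    rw [← Measure.restrict_univ (μ := (volume : Measure ℝ)), ← hU, aemeasurable_iUnion_iff]
    intro v
    have hms : MeasurableSet (φ ⁻¹' {(v : X)}) := φ.measurableSet_fiber v
    refine aemeasurable_restrict_of_antitoneOn hms ?_
    intro a ha b hb hab
    have ha' : w.eval f a = v := by rw [← hφ]; exact ha
    have hb' : w.eval f b = v := by rw [← hφ]; exact hb
    change w.normY b (w.eval f b) ≤ w.normY a (w.eval f a)
    rw [ha', hb']
    exact w.normY_anti hab (ha' ▸ (hC a).1)
  refine IntegrableOn.of_bound (by simp) hm.aestronglyMeasurable.restrict C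
    (Eventually.of_forall fun r => ?_)
  exact (Real.norm_of_nonneg (gauge_nonneg _)).trans_le (hC r).2

/-- The seminorm `‖f‖ = ∫_0^1 |f(r)|_r dr` on the simple functions. -/
noncomputable def simpleSeminorm : Seminorm 𝕜 w.Simple :=
  Seminorm.of (fun f => ∫ r in Ioo (0 : ℝ) 1, w.normY r (w.eval f r))
    (fun f g => by
      rw [← integral_add (w.simple_integrable f) (w.simple_integrable g)]
      refine integral_mono (w.simple_integrable (f + g))
        ((w.simple_integrable f).add (w.simple_integrable g)) fun r => ?_
      obtain ⟨C, hC⟩ := w.simple_bounded f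
      obtain ⟨D, hD⟩ := w.simple_bounded g
      exact w.normY_add_le (hC r).1 (hD r).1)
    (fun c f => by
      rw [← integral_const_mul]
      exact integral_congr_ae (Eventually.of_forall fun r => w.normY_smul r c (w.eval f r)))

noncomputable instance : SeminormedAddCommGroup w.Simple :=
  w.simpleSeminorm.toAddGroupSeminorm.toSeminormedAddCommGroup

theorem norm_simple (f : w.Simple) : ‖f‖ = ∫ r in Ioo (0 : ℝ) 1, w.normY r (w.eval f r) := rfl

noncomputable instance : NormedSpace 𝕜 w.Simple where
  norm_smul_le c f := (map_smul_eq_mul w.simpleSeminorm c f).le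

/-- The Willis space: the (Hausdorff) completion of the space of simple functions. Simple
functions that agree almost everywhere are identified in it. -/
def Space : Type _ := UniformSpace.Completion w.Simple

noncomputable instance : NormedAddCommGroup w.Space :=
  inferInstanceAs (NormedAddCommGroup (UniformSpace.Completion w.Simple))

noncomputable instance : NormedSpace 𝕜 w.Space :=
  inferInstanceAs (NormedSpace 𝕜 (UniformSpace.Completion w.Simple))

instance : CompleteSpace w.Space :=
  inferInstanceAs (CompleteSpace (UniformSpace.Completion w.Simple))

end

end WillisSequence

/-! Write `K = U_0` for the hull of the sequence itself. The norm of `Z` is of `L¹` type over a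
scale of spaces in which `Y_s` sits compactly in `Y_t` for `s < t`: the generators of `U_s` are
those of `U_t` times `‖x_n‖ ^ (t - s)`, and these factors tend to `0`.

Choose disjoint blocks `(p_(n+1), p_n)` below `1/2`. Let `T_n` integrate over the `n`-th block,
include the result of `Y_(p_n)` in `Y_(1/2)`, and spread it over `(1/2, 3/4)`. The inclusion makes
`T_n` compact. Since the blocks are disjoint, the `L¹` norm gives `‖∑ a_n T_n‖ ≤ sup |a_n|`
(`sum_norm_integralMap_le`, `norm_sum_smul_block_le`), so the series converges in norm for `a` in
`c₀`, with compact sum.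

For the distance to a finite rank operator `V`, feed in `y` on the `m`-th block, with `y ∈
Y_(p_(m+1))`, and integrate the output over `(1/2, 3/4)`. Only `T_m` responds, by a multiple of `y`,
so `V` compresses to a finite rank `W : Y_(p_(m+1)) → X` with `‖y - W y‖ ≤ ‖∑ a_n T_n - V‖ / |a_m|`
on the unit ball, hence on `K`. This `W` need not be continuous for the norm of `X`, but `K` is
compact in `Y_(p_(m+1))`, and Hahn-Banach yields a finite rank operator on `X` close to `W` on `K`
(`exists_functional_approx`, `exists_finiteRank_approx`). The constant `c` of the sequence then
bounds the distance below by `c |a_m|`, so `δ = c` works.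

Admissible sequences come from Grothendieck's theorem that a compact set lies in the closed convex
hull of a null sequence (`IsCompact.exists_null_set`). -/

namespace WillisSequence

/-! ### The spaces `Y_t`: completeness, compact inclusions, approximation by operators on `X` -/

section YSpace

variable {𝕜 X : Type*} [RCLike 𝕜] [NormedAddCommGroup X] [NormedSpace 𝕜 X]
  [NormedSpace ℝ X] (w : WillisSequence 𝕜 X)

theorem isClosed_U (t : ℝ) : IsClosed (w.U t) := isClosed_closure

theorem U_subset_Y (t : ℝ) : w.U t ⊆ w.Y t := Submodule.subset_span

theorem U_zero : w.U 0 = closedCircledHull 𝕜 w.x := by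
  simp [U]

theorem normY_le_of_mem_smul_U {t r : ℝ} (hr : 0 ≤ r) {y : X} (h : y ∈ r • w.U t) :
    w.normY t y ≤ r :=
  gauge_le_of_mem hr h

/-- The generators have norm `‖x_n‖ ^ (1 - t) ≤ 1`. Hence `|·|_t` dominates the norm of `X`, which
makes it definite and the inclusion into `X` continuous. -/
theorem U_subset_closedBall {t : ℝ} (ht : t ≤ 1) : w.U t ⊆ Metric.closedBall 0 1 := by
  refine closure_minimal (convexHull_min ?_ (convex_closedBall _ _)) Metric.isClosed_closedBall
  rintro _ ⟨n, c, hc, rfl⟩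
  have hp := w.norm_pos n
  rw [mem_closedBall_zero_iff, norm_smul, hc, one_mul, norm_smul, norm_inv, Real.norm_of_nonneg
    (by positivity), inv_mul_le_one₀ (by positivity)]
  calc ‖w.x n‖ = ‖w.x n‖ ^ (1 : ℝ) := (Real.rpow_one _).symm
    _ ≤ ‖w.x n‖ ^ t := Real.rpow_le_rpow_of_exponent_ge hp (w.norm_le_one n) ht

/-- The space `Y_t` as a type of its own, normed by `|·|_t`. The bound `t ≤ 1` makes `|·|_t`
definite. -/
def YSpace (t : ℝ) (_ : t ≤ 1) : Type _ := w.Y t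

variable {t : ℝ} {ht : t ≤ 1}

instance : AddCommGroup (w.YSpace t ht) := inferInstanceAs (AddCommGroup (w.Y t))

instance : Module 𝕜 (w.YSpace t ht) := inferInstanceAs (Module 𝕜 (w.Y t))

/-- The inclusion of `Y_t` into `X` as a linear map. -/
def valₗ (t : ℝ) (ht : t ≤ 1) : w.YSpace t ht →ₗ[𝕜] X := (w.Y t).subtype

theorem valₗ_injective : Function.Injective (w.valₗ t ht) := Subtype.val_injective

theorem valₗ_mem (y : w.YSpace t ht) : w.valₗ t ht y ∈ w.Y t := y.2

/-- An element of `Y_t` as an element of the normed space. -/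
def mkY (ht : t ≤ 1) (y : X) (hy : y ∈ w.Y t) : w.YSpace t ht := ⟨y, hy⟩

variable [IsScalarTower ℝ 𝕜 X]

theorem zero_mem_U (t : ℝ) : (0 : X) ∈ w.U t := (w.balanced_U t).zero_mem (w.nonempty_U t)

theorem smul_U_subset_Y (t r : ℝ) : r • w.U t ⊆ w.Y t := by
  rintro _ ⟨z, hz, rfl⟩
  change r • z ∈ w.Y t
  rw [← algebraMap_smul 𝕜 r z]
  exact Submodule.smul_mem _ _ (w.U_subset_Y t hz)

theorem mem_smul_U_of_normY_lt {t r : ℝ} {y : X} (hy : y ∈ w.Y t) (h : w.normY t y < r) :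
    y ∈ r • w.U t := by
  obtain ⟨q, ⟨hq, z, hz, rfl⟩, hqr⟩ := exists_lt_of_csInf_lt
    (show {r ∈ Ioi (0 : ℝ) | y ∈ r • w.U t}.Nonempty from
      exists_mem_smul_of_mem_span (w.convex_U t) (w.balanced_U t) (w.nonempty_U t) hy) h
  have hq : 0 < q := hq
  have hr : 0 < r := hq.trans hqr
  refine ⟨(q / r) • z, (w.convex_U t).smul_mem_of_zero_mem (w.zero_mem_U t) hz
    ⟨by positivity, (div_le_one hr).2 hqr.le⟩, ?_⟩
  change r • (q / r) • z = q • z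
  rw [smul_smul, mul_div_cancel₀ _ hr.ne']

theorem norm_le_normY {t : ℝ} (ht : t ≤ 1) {y : X} (hy : y ∈ w.Y t) : ‖y‖ ≤ w.normY t y := by
  refine le_of_forall_gt_imp_ge_of_dense fun r hr => ?_
  have hr0 : 0 < r := (gauge_nonneg _).trans_lt hr
  obtain ⟨z, hz, rfl⟩ := w.mem_smul_U_of_normY_lt hy hr
  have := mem_closedBall_zero_iff.1 (w.U_subset_closedBall ht hz)
  change ‖r • z‖ ≤ r
  rw [norm_smul, Real.norm_of_nonneg hr0.le]
  nlinarith

noncomputable instance : NormedAddCommGroup (w.YSpace t ht) :=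
  AddGroupNorm.toNormedAddCommGroup
    { toFun := fun y => w.normY t (w.valₗ t ht y)
      map_zero' := by simp [normY]
      add_le' := fun y z => by
        rw [map_add]
        exact w.normY_add_le (w.valₗ_mem y) (w.valₗ_mem z)
      neg' := fun y => by
        rw [map_neg, ← neg_one_smul 𝕜, w.normY_smul]
        simp
      eq_zero_of_map_eq_zero' := fun y hy => by
        have h := w.norm_le_normY ht (w.valₗ_mem y)
        rw [hy] at h
        exact w.valₗ_injective (by simpa using norm_le_zero_iff.1 h) }

theorem norm_YSpace (y : w.YSpace t ht) : ‖y‖ = w.normY t (w.valₗ t ht y) := rfl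

noncomputable instance : NormedSpace 𝕜 (w.YSpace t ht) where
  norm_smul_le c y := by
    rw [norm_YSpace, norm_YSpace, map_smul, w.normY_smul]

noncomputable instance : NormedSpace ℝ (w.YSpace t ht) :=
  NormedSpace.restrictScalars ℝ 𝕜 (w.YSpace t ht)

instance : IsScalarTower ℝ 𝕜 (w.YSpace t ht) where
  smul_assoc r c y := by
    change (r • c) • y = algebraMap ℝ 𝕜 r • c • y
    rw [Algebra.smul_def, mul_smul]

/-- The inclusion of `Y_t` into `X`. -/
noncomputable def val (t : ℝ) (ht : t ≤ 1) : w.YSpace t ht →L[𝕜] X :=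
  (w.valₗ t ht).mkContinuous 1 fun y => by
    rw [one_mul]
    exact w.norm_le_normY ht (w.valₗ_mem y)

theorem val_eq_coe (y : w.YSpace t ht) :
    w.val t ht y = ((show w.Y t from y : w.Y t) : X) := rfl

theorem val_mem (y : w.YSpace t ht) : w.val t ht y ∈ w.Y t := w.valₗ_mem y

theorem val_injective : Function.Injective (w.val t ht) := w.valₗ_injective

@[simp]
theorem val_mkY (y : X) (hy : y ∈ w.Y t) : w.val t ht (w.mkY ht y hy) = y := rfl

theorem norm_val_le (y : w.YSpace t ht) : ‖w.val t ht y‖ ≤ ‖y‖ :=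
  w.norm_le_normY ht (w.valₗ_mem y)

theorem norm_eq_normY_val (y : w.YSpace t ht) : ‖y‖ = w.normY t (w.val t ht y) := rfl

theorem val_real_smul (r : ℝ) (y : w.YSpace t ht) : w.val t ht (r • y) = r • w.val t ht y := by
  rw [← algebraMap_smul 𝕜 r y, map_smul, algebraMap_smul]

theorem norm_le_of_val_mem_smul_U {r : ℝ} (hr : 0 ≤ r) {y : w.YSpace t ht}
    (h : w.val t ht y ∈ r • w.U t) : ‖y‖ ≤ r :=
  w.normY_le_of_mem_smul_U hr h

/-- A Cauchy sequence has a limit in `X`. As `ε • U_t` is closed in `X`, the relations `u_n - u_m ∈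
ε • U_t` survive `m → ∞`; the case `ε = 1` puts the limit in `Y_t`, small `ε` gives convergence
there. -/
instance [CompleteSpace X] : CompleteSpace (w.YSpace t ht) := by
  refine Metric.complete_of_cauchySeq_tendsto fun u hu => ?_
  obtain ⟨x, hx⟩ := cauchySeq_tendsto_of_complete
    ((w.val t ht).uniformContinuous.comp_cauchySeq hu)
  have key : ∀ ε : ℝ, 0 < ε → ∃ N, ∀ n ≥ N, w.val t ht (u n) - x ∈ ε • w.U t := by
    intro ε hε
    obtain ⟨N, hN⟩ := Metric.cauchySeq_iff.1 hu ε hε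
    refine ⟨N, fun n hn => ?_⟩
    refine ((w.isClosed_U t).smul_of_ne_zero hε.ne').mem_of_tendsto
      (tendsto_const_nhds.sub hx) (eventually_atTop.2 ⟨N, fun m hm => ?_⟩)
    have h := hN n hn m hm
    rw [dist_eq_norm, norm_eq_normY_val] at h
    have := w.mem_smul_U_of_normY_lt (w.val_mem _) h
    rwa [map_sub] at this
  obtain ⟨N, hN⟩ := key 1 one_pos
  have hxY : x ∈ w.Y t := by
    have := sub_mem (w.val_mem (u N)) (w.smul_U_subset_Y t 1 (hN N le_rfl))
    rwa [sub_sub_cancel] at this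
  refine ⟨w.mkY ht x hxY, Metric.tendsto_atTop.2 fun ε hε => ?_⟩
  obtain ⟨N, hN⟩ := key (ε / 2) (half_pos hε)
  refine ⟨N, fun n hn => ?_⟩
  rw [dist_eq_norm]
  refine (w.norm_le_of_val_mem_smul_U (half_pos hε).le ?_).trans_lt (half_lt_self hε)
  rw [map_sub]
  exact hN n hn

/-- Up to a small multiple of `U_t`, the set `U_s` with `s < t` lies in a compact set of
combinations of finitely many of its generators. -/
theorem U_subset_add_smul_U {s : ℝ} (hst : s < t) {ε : ℝ} (hε : 0 < ε) :
    ∃ N : ℕ, w.U s ⊆ (fun l : Fin N → 𝕜 => ∑ i, l i • (‖w.x i‖ ^ s)⁻¹ • w.x i) ''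
      Metric.closedBall 0 1 + ε • w.U t := by
  -- The `n`-th generator of `U_s` is `‖x_n‖ ^ (t - s)` times that of `U_t`, so it lies in `ε • U_t`
  -- from some index `N` on.
  have hlim : Tendsto (fun n => ‖w.x n‖ ^ (t - s)) atTop (𝓝 0) := by
    have := w.tendsto_norm.rpow_const (p := t - s) (Or.inr (sub_nonneg.2 hst.le))
    rwa [Real.zero_rpow (sub_pos.2 hst).ne'] at this
  obtain ⟨N, hN⟩ := eventually_atTop.1 (hlim.eventually (gt_mem_nhds hε))
  refine ⟨N, ?_⟩
  let L : (Fin N → 𝕜) →ₗ[ℝ] X :=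
    { toFun := fun l => ∑ i, l i • (‖w.x i‖ ^ s)⁻¹ • w.x i
      map_add' := fun a b => by simp [add_smul, Finset.sum_add_distrib]
      map_smul' := fun r a => by simp [Finset.smul_sum] }
  have hL : Continuous L := by
    change Continuous fun l : Fin N → 𝕜 => ∑ i, l i • (‖w.x i‖ ^ s)⁻¹ • w.x i
    fun_prop
  change _ ⊆ L '' Metric.closedBall 0 1 + ε • w.U t
  have hK : IsCompact (L '' Metric.closedBall 0 1) := (isCompact_closedBall _ _).image hL
  -- Compact plus closed is closed, and the sum is convex, so only the generators need checking.
  refine closure_minimal (convexHull_min ?_ ?_)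
    (((w.isClosed_U t).smul_of_ne_zero hε.ne').add_left_of_isCompact hK)
  · rintro _ ⟨n, c, hc, rfl⟩
    by_cases hn : n < N
    · refine ⟨L (Pi.single ⟨n, hn⟩ c), ⟨_, ?_, rfl⟩, 0, ⟨0, w.zero_mem_U t, smul_zero _⟩, ?_⟩
      · rw [mem_closedBall_zero_iff, Pi.norm_single, hc]
      · change (∑ i, (Pi.single ⟨n, hn⟩ c : Fin N → 𝕜) i • (‖w.x i‖ ^ s)⁻¹ • w.x i) + 0 = _
        rw [add_zero, Finset.sum_eq_single ⟨n, hn⟩]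
        · simp
        · intro i _ hi
          rw [Pi.single_eq_of_ne hi, zero_smul]
        · simp
    · refine ⟨0, ⟨0, by simp, map_zero L⟩, _, ?_, zero_add _⟩
      have hp := w.norm_pos n
      have hlt := hN n (not_lt.1 hn)
      refine ⟨(‖w.x n‖ ^ (t - s) / ε) • c • (‖w.x n‖ ^ t)⁻¹ • w.x n,
        (w.convex_U t).smul_mem_of_zero_mem (w.zero_mem_U t)
          ((w.balanced_U t).smul_mem hc.le (mem_closedCircledHull _ n))
          ⟨by positivity, (div_le_one hε).2 hlt.le⟩, ?_⟩
      change ε • (‖w.x n‖ ^ (t - s) / ε) • c • (‖w.x n‖ ^ t)⁻¹ • w.x n =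
        c • (‖w.x n‖ ^ s)⁻¹ • w.x n
      rw [smul_smul, mul_div_cancel₀ _ hε.ne', smul_comm, smul_smul, ← Real.rpow_neg hp.le,
        ← Real.rpow_add hp, ← Real.rpow_neg hp.le]
      congr 3
      ring
  · exact ((convex_closedBall _ _).linear_image L).add ((w.convex_U t).smul ε)

/-- The set `U_s` is compact in `Y_t` if `s < t`. -/
theorem isCompact_preimage_U [CompleteSpace X] {s : ℝ} (hst : s < t) :
    IsCompact (w.val t ht ⁻¹' w.U s) := by
  refine TotallyBounded.isCompact_of_isClosed (Metric.totallyBounded_iff.2 fun ε hε => ?_)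
    ((w.isClosed_U s).preimage (w.val t ht).continuous)
  obtain ⟨N, hN⟩ := w.U_subset_add_smul_U hst (half_pos hε)
  have hmem : ∀ i, (‖w.x i‖ ^ s)⁻¹ • w.x i ∈ w.Y t := fun i =>
    w.Y_mono hst.le (w.U_subset_Y s (mem_closedCircledHull _ i))
  -- The same finite combinations, now taken in `Y_t`: their set is compact for `|·|_t`, and a
  -- finite `ε / 2`-net of it is an `ε`-net of `U_s`.
  let F : (Fin N → 𝕜) → w.YSpace t ht := fun l => ∑ i, l i • w.mkY ht _ (hmem i)
  have hF : Continuous F := by fun_prop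
  have hK : IsCompact (F '' Metric.closedBall 0 1) := (isCompact_closedBall _ _).image hF
  obtain ⟨S, hS, hcov⟩ := Metric.totallyBounded_iff.1 hK.totallyBounded (ε / 2) (half_pos hε)
  refine ⟨S, hS, fun y hy => ?_⟩
  obtain ⟨_, ⟨l, hl, rfl⟩, q, hq, hsum⟩ := hN hy
  obtain ⟨z, hz, hzl⟩ := mem_iUnion₂.1 (hcov ⟨l, hl, rfl⟩)
  refine mem_iUnion₂.2 ⟨z, hz, ?_⟩
  have h1 : dist y (F l) ≤ ε / 2 := by
    rw [dist_eq_norm]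
    refine w.norm_le_of_val_mem_smul_U (half_pos hε).le ?_
    have : w.val t ht y - w.val t ht (F l) = q := by
      rw [← hsum]
      simp [F]
    rwa [map_sub, this]
  have h2 : dist (F l) z < ε / 2 := hzl
  exact Metric.mem_ball.2 (by linarith [dist_triangle y (F l) z])

/-- The inclusion of `Y_s` into `Y_t` for `s ≤ t` as a linear map. -/
def inclₗ {s : ℝ} (hs : s ≤ 1) (ht : t ≤ 1) (hst : s ≤ t) :
    w.YSpace s hs →ₗ[𝕜] w.YSpace t ht :=
  Submodule.inclusion (w.Y_mono hst)

theorem val_inclₗ {s : ℝ} (hs : s ≤ 1) (hst : s ≤ t) (y : w.YSpace s hs) :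
    w.val t ht (w.inclₗ hs ht hst y) = w.val s hs y := by
  rw [val_eq_coe, val_eq_coe]
  exact Submodule.coe_inclusion (w.Y_mono hst) (show w.Y s from y)

theorem norm_inclₗ_le {s : ℝ} (hs : s ≤ 1) (hst : s ≤ t) (y : w.YSpace s hs) :
    ‖w.inclₗ hs ht hst y‖ ≤ ‖y‖ := by
  rw [norm_eq_normY_val, norm_eq_normY_val, val_inclₗ]
  exact w.normY_anti hst (w.val_mem y)

/-- The inclusion of `Y_s` into `Y_t` for `s ≤ t`. -/
noncomputable def incl {s : ℝ} (hs : s ≤ 1) (ht : t ≤ 1) (hst : s ≤ t) :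
    w.YSpace s hs →L[𝕜] w.YSpace t ht :=
  (w.inclₗ hs ht hst).mkContinuous 1 fun y => by
    rw [one_mul]
    exact w.norm_inclₗ_le hs hst y

@[simp]
theorem val_incl {s : ℝ} (hs : s ≤ 1) (hst : s ≤ t) (y : w.YSpace s hs) :
    w.val t ht (w.incl hs ht hst y) = w.val s hs y :=
  w.val_inclₗ hs hst y

theorem norm_incl_le {s : ℝ} (hs : s ≤ 1) (hst : s ≤ t) (y : w.YSpace s hs) :
    ‖w.incl hs ht hst y‖ ≤ ‖y‖ :=
  w.norm_inclₗ_le hs hst y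

/-- The open unit ball of `Y_s` is contained in `U_s`, which is compact in `Y_t`. -/
theorem isCompactOperator_incl [CompleteSpace X] {s : ℝ} (hs : s ≤ 1) (hst : s < t) :
    IsCompactOperator (w.incl hs ht hst.le) := by
  refine ⟨_, w.isCompact_preimage_U hst, mem_of_superset (Metric.ball_mem_nhds 0 one_pos) ?_⟩
  intro y hy
  rw [mem_preimage, mem_preimage, val_incl]
  rw [mem_ball_zero_iff, norm_eq_normY_val] at hy
  have := w.mem_smul_U_of_normY_lt (w.val_mem y) hy
  rwa [one_smul] at this

/-- A bounded linear functional on `Y_t` can be approximated, uniformly on `U_s` with `s < t`, by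
bounded linear functionals on `X`. -/
theorem exists_functional_approx [CompleteSpace X] {s : ℝ} (hst : s < t)
    (φ : w.YSpace t ht →L[𝕜] 𝕜) {ε : ℝ} (hε : 0 < ε) :
    ∃ g : X →L[𝕜] 𝕜, ∀ y, w.val t ht y ∈ w.U s → ‖g (w.val t ht y) - φ y‖ ≤ ε := by
  let G : w.YSpace t ht →L[𝕜] X × 𝕜 := (w.val t ht).prod φ
  set C : Set (w.YSpace t ht) := w.val t ht ⁻¹' w.U s with hC
  have hCc : Convex ℝ C := by
    intro y hy z hz a b ha hb hab
    change w.val t ht (a • y + b • z) ∈ w.U s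
    rw [map_add, val_real_smul, val_real_smul]
    exact w.convex_U s hy hz ha hb hab
  have hA : IsCompact (G '' C) := (w.isCompact_preimage_U hst).image G.continuous
  have hAc : Convex ℝ (G '' C) := hCc.linear_image (G.restrictScalars ℝ).toLinearMap
  have h0 : (0 : w.YSpace t ht) ∈ C := by simpa [hC] using w.zero_mem_U s
  -- `G '' C` is the graph of `φ` over `U_s`, compact and convex in `X × 𝕜`. Injectivity of the
  -- inclusion into `X` makes it disjoint from its translate by `(0, ε)`; the functional separating
  -- the two, solved for its second coordinate, gives the approximant `-c⁻¹ g`.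
  set B : Set (X × 𝕜) := (fun p => ((0 : X), (ε : 𝕜)) + p) '' (G '' C) with hB
  have hdisj : Disjoint (G '' C) B := by
    rw [Set.disjoint_left]
    rintro _ ⟨y, -, rfl⟩ ⟨_, ⟨z, -, rfl⟩, hz⟩
    have h1 : w.val t ht z = w.val t ht y := by simpa [G] using congrArg Prod.fst hz
    have h2 : (ε : 𝕜) + φ z = φ y := by simpa [G] using congrArg Prod.snd hz
    rw [w.val_injective h1] at h2
    simp [hε.ne'] at h2
  obtain ⟨f, u, v, hu, huv, hv⟩ := RCLike.geometric_hahn_banach_compact_closed (𝕜 := 𝕜) hAc hA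
    (hAc.translate _) (hA.image (by fun_prop)).isClosed hdisj
  let g : X →L[𝕜] 𝕜 := f.comp (ContinuousLinearMap.inl 𝕜 X 𝕜)
  set c : 𝕜 := f (0, 1) with hc
  have hf : ∀ p : X × 𝕜, f p = g p.1 + c * p.2 := by
    intro p
    have : p = (p.1, 0) + p.2 • ((0 : X), (1 : 𝕜)) := by ext <;> simp
    conv_lhs => rw [this]
    rw [map_add, map_smul, smul_eq_mul, mul_comm]
    rfl
  -- The separation is tested at the origin of the graph: the translated copy gives this bound, the
  -- graph itself gives `0 < u`.
  have hv0 : v < ε * RCLike.re c := by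
    have := hv (((0 : X), (ε : 𝕜)) + G 0) ⟨_, ⟨0, h0, rfl⟩, rfl⟩
    simpa [hf, mul_comm] using this
  have hle : ∀ y ∈ C, ‖g (w.val t ht y) + c * φ y‖ ≤ ε * RCLike.re c := by
    intro y hy
    -- Rotating `y` inside the balanced set turns the bound on real parts into one on absolute
    -- values.
    obtain ⟨θ, hθ, hθy⟩ := RCLike.exists_norm_eq_mul_self (g (w.val t ht y) + c * φ y)
    have hmem : θ • y ∈ C := by
      change w.val t ht (θ • y) ∈ w.U s
      rw [map_smul]
      exact (w.balanced_U s).smul_mem hθ.le hy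
    have h1 := hu _ ⟨_, hmem, rfl⟩
    have h2 : f (G (θ • y)) = θ * (g (w.val t ht y) + c * φ y) := by
      rw [map_smul, map_smul, hf]
      rfl
    rw [h2, ← hθy, RCLike.ofReal_re] at h1
    linarith
  have hc0 : 0 < RCLike.re c := by
    have h2 := hu _ ⟨0, h0, rfl⟩
    simp only [map_zero] at h2
    exact pos_of_mul_pos_right (h2.trans (huv.trans hv0)) hε.le
  have hcn : RCLike.re c ≤ ‖c‖ := RCLike.re_le_norm c
  have hcp : 0 < ‖c‖ := hc0.trans_le hcn
  refine ⟨(-c⁻¹) • g, fun y hy => ?_⟩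
  have h1 : ((-c⁻¹) • g) (w.val t ht y) - φ y = -c⁻¹ * (g (w.val t ht y) + c * φ y) := by
    have : c ≠ 0 := norm_pos_iff.1 hcp
    simp only [FunLike.coe_smul, Pi.smul_apply, smul_eq_mul]
    field_simp
    ring
  rw [h1, norm_mul, norm_neg, norm_inv, inv_mul_le_iff₀ hcp]
  calc _ ≤ ε * RCLike.re c := hle y hy
    _ ≤ ‖c‖ * ε := by nlinarith

/-- A bounded finite rank operator from `Y_t` to `X` can be approximated, uniformly on `U_s` with
`s < t`, by bounded finite rank operators on `X`. -/
theorem exists_finiteRank_approx [CompleteSpace X] {s : ℝ} (hst : s < t)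
    (W : w.YSpace t ht →L[𝕜] X) (hW : FiniteDimensional 𝕜 (LinearMap.range W.toLinearMap))
    {ε : ℝ} (hε : 0 < ε) :
    ∃ V ∈ finiteRankOperators 𝕜 X,
      ∀ y, w.val t ht y ∈ w.U s → ‖V (w.val t ht y) - W y‖ ≤ ε := by
  let b := Module.finBasis 𝕜 (LinearMap.range W.toLinearMap)
  let W' : w.YSpace t ht →L[𝕜] LinearMap.range W.toLinearMap :=
    W.codRestrict _ fun y => ⟨y, rfl⟩
  let φ := fun i => (LinearMap.toContinuousLinearMap (b.coord i)).comp W'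
  -- The `1` keeps `M` positive when the range is trivial.
  set M : ℝ := ∑ i, ‖(b i : X)‖ + 1 with hM
  have hM0 : 0 < M := by positivity
  choose g hg using fun i => w.exists_functional_approx hst (φ i) (div_pos hε hM0)
  have hWy : ∀ y, W y = ∑ i, φ i y • (b i : X) := by
    intro y
    have h := congrArg (Submodule.subtype _) (b.sum_repr (W' y))
    rw [map_sum] at h
    simp only [map_smul] at h
    exact h.symm
  refine ⟨∑ i, (g i).smulRight (b i : X), ?_, fun y hy => ?_⟩
  · refine Submodule.sum_mem _ fun i _ => ?_
    refine Submodule.finiteDimensional_of_le (S₂ := Submodule.span 𝕜 {(b i : X)}) ?_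
    rintro _ ⟨x, rfl⟩
    exact Submodule.smul_mem _ _ (Submodule.mem_span_singleton_self _)
  · rw [hWy, sum_apply, ← Finset.sum_sub_distrib]
    calc _ ≤ ∑ i, ε / M * ‖(b i : X)‖ := by
          refine norm_sum_le_of_le _ fun i _ => ?_
          rw [ContinuousLinearMap.smulRight_apply, ← sub_smul, norm_smul]
          exact mul_le_mul_of_nonneg_right (hg i y hy) (norm_nonneg _)
      _ = ε / M * (M - 1) := by rw [← Finset.mul_sum, hM]; ring
      _ ≤ ε := by
          rw [div_mul_eq_mul_div, div_le_iff₀ hM0]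
          nlinarith

end YSpace

end WillisSequence

namespace WillisSequence

/-! ### Integrals over intervals and indicator functions as bounded maps between `Z` and the `Y_t`
-/

section Integration

variable {𝕜 X : Type*} [RCLike 𝕜] [NormedAddCommGroup X] [NormedSpace 𝕜 X]
  [NormedSpace ℝ X] (w : WillisSequence 𝕜 X)

theorem eval_add (f g : w.Simple) : w.eval (f + g) = w.eval f + w.eval g := rfl

theorem eval_smul (c : 𝕜) (f : w.Simple) : w.eval (c • f) = c • w.eval f := rfl

theorem eval_injective : Function.Injective w.eval := Subtype.val_injective

variable [IsScalarTower ℝ 𝕜 X]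

theorem eval_mem_Y (f : w.Simple) (r : ℝ) : w.eval f r ∈ w.Y r :=
  let ⟨_, hC⟩ := w.simple_bounded f
  (hC r).1

variable {b : ℝ}

/-- The function `f χ_(a,b)` for a simple function `f`, as a function with values in `Y_b`. -/
noncomputable def restrictFun (a : ℝ) (hb : b ≤ 1) (f : w.Simple) (r : ℝ) : w.YSpace b hb :=
  w.mkY hb ((Ioo a b).indicator (w.eval f) r) (by
    by_cases hr : r ∈ Ioo a b
    · rw [indicator_of_mem hr]
      exact w.Y_mono hr.2.le (w.eval_mem_Y f r)
    · rw [indicator_of_notMem hr]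
      exact zero_mem _)

variable {hb : b ≤ 1}

theorem val_restrictFun (a : ℝ) (f : w.Simple) (r : ℝ) :
    w.val b hb (w.restrictFun a hb f r) = (Ioo a b).indicator (w.eval f) r :=
  w.val_mkY _ _

theorem restrictFun_add (a : ℝ) (f g : w.Simple) :
    w.restrictFun a hb (f + g) = w.restrictFun a hb f + w.restrictFun a hb g := by
  ext r
  apply w.val_injective
  rw [Pi.add_apply, map_add]
  simp only [val_restrictFun, eval_add, indicator_add']
  rfl

theorem restrictFun_smul (a : ℝ) (c : 𝕜) (f : w.Simple) :
    w.restrictFun a hb (c • f) = c • w.restrictFun a hb f := by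
  ext r
  apply w.val_injective
  rw [Pi.smul_apply, map_smul]
  simp only [val_restrictFun, eval_smul]
  by_cases hr : r ∈ Ioo a b <;> simp [hr]

theorem exists_simpleFunc_restrictFun (a : ℝ) (f : w.Simple) :
    ∃ φ : SimpleFunc ℝ (w.YSpace b hb), ⇑φ = w.restrictFun a hb f := by
  suffices h : ∀ g ∈ w.simpleFunctions, ∃ φ : SimpleFunc ℝ (w.YSpace b hb),
      ∀ r, w.val b hb (φ r) = (Ioo a b).indicator g r by
    obtain ⟨φ, hφ⟩ := h _ (show w.simpleFunctions from f).2
    exact ⟨φ, funext fun r => w.val_injective ((hφ r).trans (w.val_restrictFun a f r).symm)⟩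
  intro g hg
  induction hg using Submodule.span_induction with
  | mem g hg =>
    obtain ⟨s, t, -, -, -, y, hy, rfl⟩ := hg
    -- If `s > b`, then `y` need not belong to `Y_b`, but `(s, t)` misses `(a, b)` and the
    -- restriction vanishes.
    by_cases hsb : s ≤ b
    · classical
      refine ⟨SimpleFunc.piecewise (Ioo a b ∩ Ioo s t) (measurableSet_Ioo.inter measurableSet_Ioo)
        (SimpleFunc.const ℝ (w.mkY hb y (w.Y_mono hsb hy))) (SimpleFunc.const ℝ 0), fun r => ?_⟩
      rw [indicator_indicator]
      by_cases hr : r ∈ Ioo a b ∩ Ioo s t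
      · rw [indicator_of_mem hr]
        exact (congrArg (w.val b hb) (if_pos hr)).trans (w.val_mkY _ _)
      · rw [indicator_of_notMem hr]
        exact (congrArg (w.val b hb) (if_neg hr)).trans (map_zero _)
    · refine ⟨0, fun r => ?_⟩
      rw [indicator_indicator, indicator_of_notMem]
      · exact map_zero _
      · rintro ⟨h1, h2⟩
        exact hsb (h2.1.trans h1.2).le
  | zero => exact ⟨0, fun r => by simp⟩
  | add g h _ _ ihg ihh =>
    obtain ⟨φ, hφ⟩ := ihg
    obtain ⟨ψ, hψ⟩ := ihh
    exact ⟨φ + ψ, fun r => by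
      rw [SimpleFunc.coe_add, Pi.add_apply, map_add, hφ, hψ, indicator_add']
      rfl⟩
  | smul c g _ ihg =>
    obtain ⟨φ, hφ⟩ := ihg
    exact ⟨c • φ, fun r => by
      rw [SimpleFunc.coe_smul, Pi.smul_apply, map_smul, hφ]
      by_cases hr : r ∈ Ioo a b <;> simp [hr]⟩

theorem integrableOn_restrictFun (a : ℝ) (f : w.Simple) :
    IntegrableOn (w.restrictFun a hb f) (Ioo a b) := by
  obtain ⟨φ, hφ⟩ := w.exists_simpleFunc_restrictFun (hb := hb) a f
  rw [← hφ]
  exact SimpleFunc.integrable_of_isFiniteMeasure φ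

theorem norm_restrictFun_le {a : ℝ} (f : w.Simple) {r : ℝ} (hr : r ∈ Ioo a b) :
    ‖w.restrictFun a hb f r‖ ≤ w.normY r (w.eval f r) := by
  rw [norm_eq_normY_val, val_restrictFun, indicator_of_mem hr]
  exact w.normY_anti hr.2.le (w.eval_mem_Y f r)

/-- Every `r` in the interval is below `b`, and `|·|_r` decreases in `r`, so measuring the values in
`Y_b` only lowers the integrand. -/
theorem norm_setIntegral_restrictFun_le {a : ℝ} (ha : 0 ≤ a) (f : w.Simple) :
    ‖∫ r in Ioo a b, w.restrictFun a hb f r‖ ≤ ∫ r in Ioo a b, w.normY r (w.eval f r) := by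
  refine norm_integral_le_of_norm_le
    ((w.simple_integrable f).mono_set (Ioo_subset_Ioo ha hb)) ?_
  filter_upwards [ae_restrict_mem measurableSet_Ioo] with r hr
  exact w.norm_restrictFun_le f hr

theorem setIntegral_normY_le {a : ℝ} (ha : 0 ≤ a) (hb : b ≤ 1) (f : w.Simple) :
    ∫ r in Ioo a b, w.normY r (w.eval f r) ≤ ‖f‖ := by
  rw [norm_simple]
  exact setIntegral_mono_set (w.simple_integrable f)
    (Eventually.of_forall fun r => gauge_nonneg _) (Ioo_subset_Ioo ha hb).eventuallyLE

/-- The map `f ↦ ∫_a^b f` from the simple functions to `Y_b`. -/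
noncomputable def simpleIntegral {a : ℝ} (ha : 0 ≤ a) (hb : b ≤ 1) :
    w.Simple →L[𝕜] w.YSpace b hb :=
  LinearMap.mkContinuous
    { toFun := fun f => ∫ r in Ioo a b, w.restrictFun a hb f r
      map_add' := fun f g => by
        rw [restrictFun_add]
        exact integral_add (w.integrableOn_restrictFun a f) (w.integrableOn_restrictFun a g)
      map_smul' := fun c f => by
        rw [restrictFun_smul]
        exact integral_smul c _ } 1 fun f => by
    rw [one_mul]
    exact (w.norm_setIntegral_restrictFun_le ha f).trans (w.setIntegral_normY_le ha hb f)

/-- The canonical map from the simple functions to the Willis space. -/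
noncomputable def toSpace : w.Simple →L[𝕜] w.Space :=
  UniformSpace.Completion.toComplL (𝕜 := 𝕜) (E := w.Simple)

theorem denseRange_toSpace : DenseRange w.toSpace :=
  UniformSpace.Completion.denseRange_coe (α := w.Simple)

theorem isUniformInducing_toSpace : IsUniformInducing w.toSpace :=
  UniformSpace.Completion.isUniformInducing_coe w.Simple

theorem norm_toSpace (f : w.Simple) : ‖w.toSpace f‖ = ‖f‖ :=
  UniformSpace.Completion.norm_coe (E := w.Simple) f

variable {c d : ℝ} (hc : 0 < c) (hcd : c < d) (hd : d < 1)

/-- The map `y ↦ y χ_(c,d)` from `Y_c` to the simple functions. -/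
noncomputable def simpleIndicator :
    w.YSpace c (hcd.trans hd).le →ₗ[𝕜] w.Simple where
  toFun y := (⟨(Ioo c d).indicator fun _ => w.val c _ y,
    Submodule.subset_span ⟨c, d, hc, hcd, hd, _, w.val_mem y, rfl⟩⟩ : w.simpleFunctions)
  map_add' y z := w.eval_injective (by
    change ((Ioo c d).indicator fun _ => w.val c _ (y + z)) =
      ((Ioo c d).indicator fun _ => w.val c _ y) + ((Ioo c d).indicator fun _ => w.val c _ z)
    rw [map_add, ← indicator_add']
    rfl)
  map_smul' k y := w.eval_injective (by
    change ((Ioo c d).indicator fun _ => w.val c _ (k • y)) =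
      k • ((Ioo c d).indicator fun _ => w.val c _ y)
    ext r
    by_cases hr : r ∈ Ioo c d <;> simp [hr])

theorem eval_simpleIndicator (y : w.YSpace c (hcd.trans hd).le) :
    w.eval (w.simpleIndicator hc hcd hd y) = (Ioo c d).indicator fun _ => w.val c _ y := rfl

/-- On `(c, d)` the integrand `|y|_r` is at most `|y|_c`. -/
theorem norm_simpleIndicator_le (y : w.YSpace c (hcd.trans hd).le) :
    ‖w.simpleIndicator hc hcd hd y‖ ≤ (d - c) * ‖y‖ := by
  rw [norm_simple]
  have hsub : Ioo c d ⊆ Ioo 0 1 := Ioo_subset_Ioo hc.le hd.le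
  calc ∫ r in Ioo 0 1, w.normY r (w.eval (w.simpleIndicator hc hcd hd y) r)
      ≤ ∫ r in Ioo 0 1, (Ioo c d).indicator (fun _ => ‖y‖) r := by
        refine integral_mono (w.simple_integrable _)
          ((integrable_indicator_iff measurableSet_Ioo).2
            (integrable_const _).integrableOn) fun r => ?_
        rw [eval_simpleIndicator]
        by_cases hr : r ∈ Ioo c d
        · simp only [indicator_of_mem hr]
          exact w.normY_anti hr.1.le (w.val_mem y)
        · simp only [indicator_of_notMem hr]
          exact gauge_zero.le
    _ = (d - c) * ‖y‖ := by
        rw [setIntegral_indicator measurableSet_Ioo, inter_eq_self_of_subset_right hsub,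
          setIntegral_const, Real.volume_real_Ioo_of_le hcd.le, smul_eq_mul]

/-- The map `y ↦ y χ_(c,d)` from `Y_c` to the Willis space. -/
noncomputable def indicatorMap : w.YSpace c (hcd.trans hd).le →L[𝕜] w.Space :=
  w.toSpace.comp ((w.simpleIndicator hc hcd hd).mkContinuous (d - c)
    (w.norm_simpleIndicator_le hc hcd hd))

theorem indicatorMap_apply (y : w.YSpace c (hcd.trans hd).le) :
    w.indicatorMap hc hcd hd y = w.toSpace (w.simpleIndicator hc hcd hd y) := rfl

theorem norm_indicatorMap_le (y : w.YSpace c (hcd.trans hd).le) :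
    ‖w.indicatorMap hc hcd hd y‖ ≤ (d - c) * ‖y‖ := by
  rw [indicatorMap_apply, norm_toSpace]
  exact w.norm_simpleIndicator_le hc hcd hd y

variable [CompleteSpace X]

/-- The map `f ↦ ∫_a^b f` from the Willis space to `Y_b`. -/
noncomputable def integralMap {a : ℝ} (ha : 0 ≤ a) (hb : b ≤ 1) :
    w.Space →L[𝕜] w.YSpace b hb :=
  (w.simpleIntegral ha hb).extend w.toSpace

theorem integralMap_toSpace {a : ℝ} (ha : 0 ≤ a) (f : w.Simple) :
    w.integralMap ha hb (w.toSpace f) = ∫ r in Ioo a b, w.restrictFun a hb f r :=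
  (w.simpleIntegral ha hb).extend_eq w.denseRange_toSpace w.isUniformInducing_toSpace f

/-- The `L¹` character of `Z`: each integral costs at most the part of the norm carried by its own
interval, and these parts add up. This is what lets the block operators span a copy of `c₀`. -/
theorem sum_norm_integralMap_le {ι : Type*} (S : Finset ι) {a b : ι → ℝ} (ha : ∀ i, 0 ≤ a i)
    (hb : ∀ i, b i ≤ 1) (hdisj : Pairwise fun i j => Disjoint (Ioo (a i) (b i)) (Ioo (a j) (b j)))
    (z : w.Space) : ∑ i ∈ S, ‖w.integralMap (ha i) (hb i) z‖ ≤ ‖z‖ := by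
  refine w.denseRange_toSpace.induction_on (p := fun z =>
    ∑ i ∈ S, ‖w.integralMap (ha i) (hb i) z‖ ≤ ‖z‖) z
    (isClosed_le (by fun_prop) continuous_norm) fun f => ?_
  have hsub : (⋃ i ∈ S, Ioo (a i) (b i)) ⊆ Ioo 0 1 :=
    iUnion₂_subset fun i _ => Ioo_subset_Ioo (ha i) (hb i)
  calc ∑ i ∈ S, ‖w.integralMap (ha i) (hb i) (w.toSpace f)‖
      ≤ ∑ i ∈ S, ∫ r in Ioo (a i) (b i), w.normY r (w.eval f r) :=
        Finset.sum_le_sum fun i _ => by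
          rw [integralMap_toSpace]
          exact w.norm_setIntegral_restrictFun_le (ha i) f
    _ = ∫ r in ⋃ i ∈ S, Ioo (a i) (b i), w.normY r (w.eval f r) :=
        (integral_biUnion_finset S (fun _ _ => measurableSet_Ioo) (fun i _ j _ hij => hdisj hij)
          fun i _ => (w.simple_integrable f).mono_set (Ioo_subset_Ioo (ha i) (hb i))).symm
    _ ≤ ∫ r in Ioo 0 1, w.normY r (w.eval f r) :=
        setIntegral_mono_set (w.simple_integrable f)
          (Eventually.of_forall fun r => gauge_nonneg _) hsub.eventuallyLE
    _ = ‖w.toSpace f‖ := by rw [norm_toSpace, norm_simple]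

theorem norm_integralMap_le {a : ℝ} (ha : 0 ≤ a) (z : w.Space) :
    ‖w.integralMap ha hb z‖ ≤ ‖z‖ := by
  simpa using w.sum_norm_integralMap_le (Finset.univ : Finset Unit) (fun _ => ha) (fun _ => hb)
    (fun i j hij => (hij (Subsingleton.elim i j)).elim) z

theorem val_integralMap_indicatorMap (y : w.YSpace c (hcd.trans hd).le) :
    w.val d hd.le (w.integralMap hc.le hd.le (w.indicatorMap hc hcd hd y)) =
      (d - c) • w.val c _ y := by
  have h : ∀ r ∈ Ioo c d, w.restrictFun c hd.le (w.simpleIndicator hc hcd hd y) r =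
      w.incl _ hd.le hcd.le y := by
    intro r hr
    apply w.val_injective
    rw [val_restrictFun, val_incl, eval_simpleIndicator, indicator_of_mem hr, indicator_of_mem hr]
  rw [indicatorMap_apply, integralMap_toSpace, setIntegral_congr_fun measurableSet_Ioo h,
    setIntegral_const, Real.volume_real_Ioo_of_le hcd.le, val_real_smul, val_incl]

theorem integralMap_indicatorMap_of_disjoint {a : ℝ} (ha : 0 ≤ a)
    (h : Disjoint (Ioo a b) (Ioo c d)) (y : w.YSpace c (hcd.trans hd).le) :
    w.integralMap ha hb (w.indicatorMap hc hcd hd y) = 0 := by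
  rw [indicatorMap_apply, integralMap_toSpace]
  refine setIntegral_eq_zero_of_forall_eq_zero fun r hr => w.val_injective ?_
  rw [val_restrictFun, eval_simpleIndicator, indicator_of_mem hr,
    indicator_of_notMem (disjoint_left.1 h hr), map_zero]

end Integration

end WillisSequence

/-- The quotient norm is the distance to the approximable operators, and by continuity of the norm a
lower bound on a set of operators passes to its closure. -/
theorem le_norm_mk_compactByApproximable {𝕜 Z : Type*} [RCLike 𝕜] [NormedAddCommGroup Z]
    [NormedSpace 𝕜 Z] (T : CompactOperators 𝕜 Z) {δ : ℝ}
    (h : ∀ V ∈ finiteRankOperators 𝕜 Z, δ ≤ ‖(T : Z →L[𝕜] Z) - V‖) :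
    δ ≤ ‖(Submodule.Quotient.mk T : CompactOperators 𝕜 Z ⧸ approximableInCompact 𝕜 Z)‖ := by
  refine le_of_forall_pos_lt_add fun ε hε => ?_
  obtain ⟨S, hS, hlt⟩ := Submodule.Quotient.norm_mk_lt
    (Submodule.Quotient.mk T : CompactOperators 𝕜 Z ⧸ approximableInCompact 𝕜 Z) hε
  refine lt_of_le_of_lt ?_ hlt
  have hmem : ((T - S : CompactOperators 𝕜 Z) : Z →L[𝕜] Z) ∈
      closure (finiteRankOperators 𝕜 Z : Set (Z →L[𝕜] Z)) :=
    (Submodule.Quotient.eq _).1 hS.symm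
  have hcl : IsClosed {V : Z →L[𝕜] Z | δ ≤ ‖(T : Z →L[𝕜] Z) - V‖} :=
    isClosed_le continuous_const (by fun_prop)
  have hle : δ ≤ ‖(T : Z →L[𝕜] Z) - ((T - S : CompactOperators 𝕜 Z) : Z →L[𝕜] Z)‖ :=
    closure_minimal (fun V hV => h V hV) hcl hmem
  rwa [Submodule.coe_sub, sub_sub_cancel] at hle

namespace WillisSequence

/-! ### The block operators and the embedding of `c₀` -/

section Blocks

variable {𝕜 X : Type*} [RCLike 𝕜] [NormedAddCommGroup X] [NormedSpace 𝕜 X]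
  [NormedSpace ℝ X] (w : WillisSequence 𝕜 X) [IsScalarTower ℝ 𝕜 X]

/-- The points `1 / (n + 3)`: the intervals `(p (n + 1), p n)` are disjoint and lie in
`(0, 1 / 2)`. -/
noncomputable def blockPoint (n : ℕ) : ℝ := ((n : ℝ) + 3)⁻¹

theorem blockPoint_pos (n : ℕ) : 0 < blockPoint n := by
  unfold blockPoint
  positivity

theorem blockPoint_strictAnti : StrictAnti blockPoint := fun m n h => by
  unfold blockPoint
  gcongr

theorem blockPoint_lt_half (n : ℕ) : blockPoint n < 1 / 2 := by
  refine (blockPoint_strictAnti.antitone (Nat.zero_le n)).trans_lt ?_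
  norm_num [blockPoint]

theorem blockPoint_lt_one (n : ℕ) : blockPoint n < 1 :=
  (blockPoint_lt_half n).trans one_half_lt_one

theorem pairwise_disjoint_blocks :
    Pairwise fun m n => Disjoint (Ioo (blockPoint (m + 1)) (blockPoint m))
      (Ioo (blockPoint (n + 1)) (blockPoint n)) := by
  have key : ∀ m n, m < n → Disjoint (Ioo (blockPoint (m + 1)) (blockPoint m))
      (Ioo (blockPoint (n + 1)) (blockPoint n)) := fun m n h =>
    disjoint_left.2 fun r hm hn =>
      (hm.1.trans hn.2).not_ge (blockPoint_strictAnti.antitone h)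
  exact fun m n h => h.lt_or_gt.elim (key m n) fun h => (key n m h).symm

/-- The map `y ↦ 4 y χ_(1/2,3/4)`. -/
noncomputable def targetMap : w.YSpace (1 / 2) (by norm_num) →L[𝕜] w.Space :=
  (4 : 𝕜) • w.indicatorMap (c := 1 / 2) (d := 3 / 4) (by norm_num) (by norm_num) (by norm_num)

theorem norm_targetMap_le (y : w.YSpace (1 / 2) (by norm_num)) : ‖w.targetMap y‖ ≤ ‖y‖ := by
  have h := w.norm_indicatorMap_le (c := 1 / 2) (d := 3 / 4) (by norm_num) (by norm_num)
    (by norm_num) y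
  change ‖(4 : 𝕜) • w.indicatorMap _ _ _ y‖ ≤ ‖y‖
  rw [norm_smul, RCLike.norm_ofNat]
  linarith

variable [CompleteSpace X]

/-- The integral over the fixed interval `(1 / 2, 3 / 4)`, as a map to `X`. -/
noncomputable def targetIntegral : w.Space →L[𝕜] X :=
  (w.val (3 / 4) (by norm_num)).comp (w.integralMap (a := 1 / 2) (by norm_num) (by norm_num))

theorem norm_targetIntegral_le (z : w.Space) : ‖w.targetIntegral z‖ ≤ ‖z‖ :=
  (w.norm_val_le _).trans (w.norm_integralMap_le _ z)

/-- The factor `4` in `targetMap` is the reciprocal of the length of `(1 / 2, 3 / 4)`. -/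
theorem targetIntegral_targetMap (y : w.YSpace (1 / 2) (by norm_num)) :
    w.targetIntegral (w.targetMap y) = w.val _ _ y := by
  have h := w.val_integralMap_indicatorMap (c := 1 / 2) (d := 3 / 4) (by norm_num) (by norm_num)
    (by norm_num) y
  change w.targetIntegral ((4 : 𝕜) • w.indicatorMap _ _ _ y) = _
  rw [map_smul]
  change (4 : 𝕜) • w.val _ _ (w.integralMap _ _ (w.indicatorMap _ _ _ y)) = _
  rw [h, ← algebraMap_smul 𝕜 ((3 / 4 : ℝ) - 1 / 2), smul_smul]
  convert one_smul 𝕜 _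
  have : (algebraMap ℝ 𝕜) (3 / 4 - 1 / 2) = 1 / 4 := by
    rw [show (3 / 4 - 1 / 2 : ℝ) = 1 / 4 by norm_num]
    rw [map_div₀, map_one, map_ofNat]
  rw [this]
  norm_num

/-- The integral over the `n`-th block. -/
noncomputable def blockIntegral (n : ℕ) : w.Space →L[𝕜] w.YSpace _ (blockPoint_lt_one n).le :=
  w.integralMap (blockPoint_pos (n + 1)).le (blockPoint_lt_one n).le

/-- The map `y ↦ y χ` for the characteristic function `χ` of the `n`-th block. -/
noncomputable def blockIndicator (n : ℕ) :
    w.YSpace _ (blockPoint_lt_one (n + 1)).le →L[𝕜] w.Space :=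
  w.indicatorMap (blockPoint_pos (n + 1)) (blockPoint_strictAnti n.lt_succ_self)
    (blockPoint_lt_one n)

/-- The contraction that integrates over the `n`-th block and spreads the result over
`(1 / 2, 3 / 4)`. -/
noncomputable def block (n : ℕ) : w.Space →L[𝕜] w.Space :=
  w.targetMap.comp ((w.incl (blockPoint_lt_one n).le _ (blockPoint_lt_half n).le).comp
    (w.blockIntegral n))

theorem block_apply (n : ℕ) (z : w.Space) :
    w.block n z = w.targetMap
      (w.incl (blockPoint_lt_one n).le _ (blockPoint_lt_half n).le (w.blockIntegral n z)) := rfl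

theorem isCompactOperator_block (n : ℕ) : IsCompactOperator (w.block n) :=
  ((w.isCompactOperator_incl (blockPoint_lt_one n).le (blockPoint_lt_half n)).comp_clm
    (w.blockIntegral n)).clm_comp w.targetMap

theorem norm_block_apply_le (n : ℕ) (z : w.Space) : ‖w.block n z‖ ≤ ‖w.blockIntegral n z‖ :=
  (w.norm_targetMap_le _).trans (w.norm_incl_le _ (blockPoint_lt_half n).le _)

theorem targetIntegral_block (n : ℕ) (z : w.Space) :
    w.targetIntegral (w.block n z) = w.val _ _ (w.blockIntegral n z) := by
  rw [block_apply, targetIntegral_targetMap, val_incl]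

/-- The norms of the block integrals of `z` sum to at most `‖z‖`, so the coefficients enter only
through their supremum. Used on tails for convergence and with `C = ‖a‖` for boundedness. -/
theorem norm_sum_smul_block_le (S : Finset ℕ) (a : ℕ → 𝕜) {C : ℝ} (hC : 0 ≤ C)
    (ha : ∀ n ∈ S, ‖a n‖ ≤ C) : ‖∑ n ∈ S, a n • w.block n‖ ≤ C := by
  refine ContinuousLinearMap.opNorm_le_bound _ hC fun z => ?_
  rw [sum_apply]
  calc ‖∑ n ∈ S, (a n • w.block n) z‖ ≤ ∑ n ∈ S, C * ‖w.blockIntegral n z‖ := by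
        refine norm_sum_le_of_le _ fun n hn => ?_
        change ‖a n • w.block n z‖ ≤ _
        rw [norm_smul]
        exact mul_le_mul (ha n hn) (w.norm_block_apply_le n z) (norm_nonneg _) hC
    _ ≤ C * ‖z‖ := by
        rw [← Finset.mul_sum]
        exact mul_le_mul_of_nonneg_left (w.sum_norm_integralMap_le S _ _
          pairwise_disjoint_blocks z) hC

theorem summable_smul_block (a : C₀(ℕ, 𝕜)) : Summable fun n => a n • w.block n := by
  refine summable_iff_vanishing_norm.2 fun ε hε => ?_
  have h := a.zero_at_infty'
  rw [cocompact_eq_cofinite] at h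
  have hfin := (Metric.tendsto_nhds.1 h (ε / 2) (half_pos hε))
  rw [eventually_cofinite] at hfin
  -- Outside this finite set of indices all coefficients are smaller than `ε / 2`.
  refine ⟨hfin.toFinset, fun S hS => ?_⟩
  refine (w.norm_sum_smul_block_le S a (half_pos hε).le fun n hn => ?_).trans_lt
    (half_lt_self hε)
  by_contra hlt
  refine Finset.disjoint_left.1 hS hn (hfin.mem_toFinset.2 ?_)
  change ¬ dist (a n) 0 < ε / 2
  rw [dist_zero_right]
  exact fun h => hlt h.le

/-- The map `a ↦ ∑ a_n T_n` for the block operators `T_n`. -/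
noncomputable def diagonal : C₀(ℕ, 𝕜) →ₗ[𝕜] w.Space →L[𝕜] w.Space where
  toFun a := ∑' n, a n • w.block n
  map_add' a b := by
    rw [← (w.summable_smul_block a).tsum_add (w.summable_smul_block b)]
    simp only [ZeroAtInftyContinuousMap.add_apply, add_smul]
  map_smul' c a := by
    rw [RingHom.id_apply, ← (w.summable_smul_block a).tsum_const_smul c]
    simp only [ZeroAtInftyContinuousMap.smul_apply, smul_assoc]

theorem hasSum_diagonal (a : C₀(ℕ, 𝕜)) : HasSum (fun n => a n • w.block n) (w.diagonal a) :=
  (w.summable_smul_block a).hasSum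

theorem norm_diagonal_le (a : C₀(ℕ, 𝕜)) : ‖w.diagonal a‖ ≤ ‖a‖ :=
  le_of_tendsto (w.hasSum_diagonal a).norm <| Eventually.of_forall fun S =>
    w.norm_sum_smul_block_le S a (norm_nonneg a) fun n _ => a.toBCF.norm_coe_le_norm n

theorem diagonal_mem (a : C₀(ℕ, 𝕜)) : w.diagonal a ∈ CompactOperators 𝕜 w.Space := by
  have hcl : IsClosed (CompactOperators 𝕜 w.Space : Set (w.Space →L[𝕜] w.Space)) :=
    isClosed_setOfPred_isCompactOperator
  refine hcl.mem_of_tendsto (w.hasSum_diagonal a) (Eventually.of_forall fun S => ?_)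
  exact Submodule.sum_mem _ fun n _ => Submodule.smul_mem _ _ (w.isCompactOperator_block n)

/-- A function living on the `m`-th block has zero integral over every other block, so a single term
of the series survives. -/
theorem targetIntegral_diagonal_blockIndicator (a : C₀(ℕ, 𝕜)) (m : ℕ)
    (y : w.YSpace _ (blockPoint_lt_one (m + 1)).le) :
    w.targetIntegral (w.diagonal a (w.blockIndicator m y)) =
      a m • (blockPoint m - blockPoint (m + 1)) • w.val _ _ y := by
  let L : (w.Space →L[𝕜] w.Space) →L[𝕜] X :=
    w.targetIntegral.comp (ContinuousLinearMap.apply 𝕜 w.Space (w.blockIndicator m y))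
  have h := (w.hasSum_diagonal a).mapL L
  have hL : ∀ n, L (a n • w.block n) =
      a n • w.val _ _ (w.blockIntegral n (w.blockIndicator m y)) := by
    intro n
    rw [map_smul, ← targetIntegral_block]
    rfl
  have h0 : ∀ n, n ≠ m → L (a n • w.block n) = 0 := by
    intro n hn
    rw [hL]
    have : w.blockIntegral n (w.blockIndicator m y) = 0 :=
      w.integralMap_indicatorMap_of_disjoint _ _ _ _ (pairwise_disjoint_blocks hn) y
    rw [this, map_zero, smul_zero]
  have h1 := h.unique (hasSum_single m h0)
  rw [hL] at h1
  exact h1.trans (congrArg (a m • ·) (w.val_integralMap_indicatorMap _ _ _ y))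

/-- A finite rank operator near the diagonal one would compress to a finite rank approximation of
the identity on `K`. -/
theorem mul_norm_le_norm_diagonal_sub {c : ℝ}
    (hc : ∀ V ∈ finiteRankOperators 𝕜 X, ∃ y ∈ closedCircledHull 𝕜 w.x, c ≤ ‖y - V y‖)
    (a : C₀(ℕ, 𝕜)) (m : ℕ) {V : w.Space →L[𝕜] w.Space}
    (hV : V ∈ finiteRankOperators 𝕜 w.Space) : c * ‖a m‖ ≤ ‖w.diagonal a - V‖ := by
  by_cases ham : a m = 0
  · simp [ham]
  set ℓ : ℝ := blockPoint m - blockPoint (m + 1) with hℓ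
  have hℓ0 : 0 < ℓ := sub_pos.2 (blockPoint_strictAnti m.lt_succ_self)
  -- Normalised so that the compression of `k • diagonal a` is exactly the inclusion into `X`.
  set k : 𝕜 := (a m * algebraMap ℝ 𝕜 ℓ)⁻¹ with hk
  have hℓ𝕜 : algebraMap ℝ 𝕜 ℓ ≠ 0 := by simpa using hℓ0.ne'
  have hk0 : a m * algebraMap ℝ 𝕜 ℓ ≠ 0 := mul_ne_zero ham hℓ𝕜
  have hkn : ‖k‖ = ‖a m‖⁻¹ * ℓ⁻¹ := by
    rw [hk, norm_inv, norm_mul, mul_inv, norm_algebraMap', Real.norm_of_nonneg hℓ0.le]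
  let W := k • w.targetIntegral.comp (V.comp (w.blockIndicator m))
  have hWfin : FiniteDimensional 𝕜 (LinearMap.range W.toLinearMap) := by
    have hV' : FiniteDimensional 𝕜 (LinearMap.range (V : w.Space →ₗ[𝕜] w.Space)) := hV
    refine Submodule.finiteDimensional_of_le (S₂ := (LinearMap.range
      (V : w.Space →ₗ[𝕜] w.Space)).map (w.targetIntegral : w.Space →ₗ[𝕜] X)) ?_
    rintro _ ⟨y, rfl⟩
    exact Submodule.smul_mem _ _ ⟨_, ⟨w.blockIndicator m y, rfl⟩, rfl⟩
  have hW : ∀ y, ‖w.val _ _ y - W y‖ ≤ ‖a m‖⁻¹ * ‖w.diagonal a - V‖ * ‖y‖ := by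
    intro y
    have h1 : w.val _ _ y - W y =
        k • w.targetIntegral ((w.diagonal a - V) (w.blockIndicator m y)) := by
      rw [sub_apply, map_sub, smul_sub, targetIntegral_diagonal_blockIndicator, ← hℓ,
        ← algebraMap_smul 𝕜 ℓ, smul_smul (a m), smul_smul k, hk, inv_mul_cancel₀ hk0, one_smul]
      rfl
    -- This `ℓ` cancels the `ℓ⁻¹` in `‖k‖`, so the bound does not deteriorate as the blocks shrink.
    have h2 : ‖w.blockIndicator m y‖ ≤ ℓ * ‖y‖ := w.norm_indicatorMap_le _ _ _ y
    calc ‖w.val _ _ y - W y‖ ≤ ‖k‖ * (‖w.diagonal a - V‖ * (ℓ * ‖y‖)) := by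
          rw [h1, norm_smul]
          refine mul_le_mul_of_nonneg_left ((w.norm_targetIntegral_le _).trans ?_) (norm_nonneg _)
          exact ((w.diagonal a - V).le_opNorm _).trans
            (mul_le_mul_of_nonneg_left h2 (norm_nonneg _))
      _ = ‖a m‖⁻¹ * ‖w.diagonal a - V‖ * ‖y‖ := by
          rw [hkn]
          field_simp
  have hpos : 0 < ‖a m‖ := norm_pos_iff.2 ham
  have hle : c ≤ ‖a m‖⁻¹ * ‖w.diagonal a - V‖ := by
    refine le_of_forall_pos_le_add fun ε hε => ?_
    -- The strict inequality `0 < blockPoint (m + 1)` leaves the room needed to approximate `W` on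
    -- `U_0 = K`.
    obtain ⟨V', hV', happ⟩ := w.exists_finiteRank_approx (blockPoint_pos (m + 1)) W hWfin hε
    obtain ⟨x, hx, hcx⟩ := hc V' hV'
    rw [← U_zero] at hx
    have hxU := w.U_mono (blockPoint_pos (m + 1)).le hx
    let y := w.mkY (blockPoint_lt_one (m + 1)).le x (w.U_subset_Y _ hxU)
    have hy : w.val _ (blockPoint_lt_one (m + 1)).le y = x := w.val_mkY _ _
    have hyn : ‖y‖ ≤ 1 := w.norm_le_of_val_mem_smul_U zero_le_one (by rwa [hy, one_smul])
    have h1 := happ y (by rwa [hy])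
    have h2 := (hW y).trans (mul_le_of_le_one_right (by positivity) hyn)
    rw [hy] at h1 h2
    have h3 : x - V' x = (x - W y) - (V' x - W y) := by abel
    calc c ≤ ‖x - V' x‖ := hcx
      _ ≤ ‖x - W y‖ + ‖V' x - W y‖ := by
          rw [h3]
          exact norm_sub_le _ _
      _ ≤ _ := add_le_add h2 h1
  rw [mul_comm, ← le_inv_mul_iff₀ hpos]
  exact hle

/-- The map `a ↦ ∑ a_n T_n` from `c₀` to the compact operators. -/
noncomputable def compactDiagonal : C₀(ℕ, 𝕜) →ₗ[𝕜] CompactOperators 𝕜 w.Space :=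
  w.diagonal.codRestrict _ w.diagonal_mem

theorem norm_compactDiagonal_le (a : C₀(ℕ, 𝕜)) : ‖w.compactDiagonal a‖ ≤ ‖a‖ :=
  w.norm_diagonal_le a

theorem mul_norm_le_norm_mk_compactDiagonal {c : ℝ} (hc0 : 0 < c)
    (hc : ∀ V ∈ finiteRankOperators 𝕜 X, ∃ y ∈ closedCircledHull 𝕜 w.x, c ≤ ‖y - V y‖)
    (a : C₀(ℕ, 𝕜)) :
    c * ‖a‖ ≤ ‖(Submodule.Quotient.mk (w.compactDiagonal a) :
      CompactOperators 𝕜 w.Space ⧸ approximableInCompact 𝕜 w.Space)‖ := by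
  refine le_norm_mk_compactByApproximable (w.compactDiagonal a) fun V hV => ?_
  rw [mul_comm, ← le_div_iff₀ hc0]
  refine (BoundedContinuousFunction.norm_le (f := a.toBCF) (by positivity)).2 fun m => ?_
  rw [le_div_iff₀ hc0, mul_comm]
  exact w.mul_norm_le_norm_diagonal_sub hc a m hV

theorem exists_embedding :
    ∃ ψ : C₀(ℕ, 𝕜) →L[𝕜] CompactByApproximable 𝕜 w.Space,
      ∃ δ : ℝ, 0 < δ ∧ ∀ a : C₀(ℕ, 𝕜), δ * ‖a‖ ≤ ‖ψ a‖ := by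
  obtain ⟨c, hc0, hc⟩ := w.fails
  let ψ : C₀(ℕ, 𝕜) →ₗ[𝕜] CompactByApproximable 𝕜 w.Space :=
    (approximableInCompact 𝕜 w.Space).mkQ ∘ₗ w.compactDiagonal
  have hψ : ∀ a, ‖ψ a‖ ≤ 1 * ‖a‖ := fun a => by
    rw [one_mul]
    exact (Submodule.Quotient.norm_mk_le _ (w.compactDiagonal a)).trans
      (w.norm_compactDiagonal_le a)
  exact ⟨ψ.mkContinuous 1 hψ, c, hc0, w.mul_norm_le_norm_mk_compactDiagonal hc0 hc⟩

end Blocks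

end WillisSequence

/-! ### Compact sets in hulls of null sequences: existence of admissible sequences -/

section NullSequence

variable {X : Type*} [NormedAddCommGroup X] [NormedSpace ℝ X]

/-- The sum is the midpoint of `d 0` and the shorter sum for the shifted sequence; the missing
weight `(1 / 2) ^ M` rests on `0`. -/
theorem Convex.sum_dyadic_mem {C : Set X} (hC : Convex ℝ C) (h0 : (0 : X) ∈ C) (M : ℕ) :
    ∀ d : ℕ → X, (∀ n, d n ∈ C) → ∑ n ∈ Finset.range M, (1 / 2 : ℝ) ^ (n + 1) • d n ∈ C := by
  induction M with
  | zero => simpa using fun _ _ => h0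
  | succ M ih =>
    intro d hd
    have h := hC (ih (fun n => d (n + 1)) fun n => hd _) (hd 0) (a := 1 / 2) (b := 1 / 2)
      (by norm_num) (by norm_num) (by norm_num)
    rw [Finset.sum_range_succ']
    convert h using 2
    · rw [Finset.smul_sum]
      refine Finset.sum_congr rfl fun n _ => ?_
      rw [smul_smul]
      congr 1
      ring
    · simp

/-- Every compact set is contained in the closed convex hull of `D ∪ {0}` for a set `D` that has
only finitely many elements outside each ball around `0`. -/
theorem IsCompact.exists_null_set {K : Set X} (hK : IsCompact K) :
    ∃ D : Set X, (∀ ε : ℝ, 0 < ε → {d ∈ D | ε ≤ ‖d‖}.Finite) ∧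
      ∀ C : Set X, Convex ℝ C → IsClosed C → (0 : X) ∈ C → D ⊆ C → K ⊆ C := by
  obtain ⟨R, hR0, hR⟩ := hK.isBounded.exists_pos_norm_lt
  -- Nets of mesh `R / 4 ^ n`; the zeroth one is `{0}` so that the later telescoping sums start at
  -- `0`.
  have hnet : ∀ n : ℕ, ∃ S : Set X, S.Finite ∧ (n = 0 → S = {0}) ∧
      ∀ x ∈ K, ∃ p ∈ S, ‖x - p‖ ≤ R * (1 / 4) ^ n := by
    intro n
    by_cases hn : n = 0
    · refine ⟨{0}, finite_singleton 0, fun _ => rfl, fun x hx => ⟨0, rfl, ?_⟩⟩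
      simpa [hn] using (hR x hx).le
    · obtain ⟨S, -, hS, hcov⟩ := hK.finite_cover_balls
        (show (0 : ℝ) < R * (1 / 4) ^ n by positivity)
      refine ⟨S, hS, fun h => absurd h hn, fun x hx => ?_⟩
      obtain ⟨p, hp, hxp⟩ := mem_iUnion₂.1 (hcov hx)
      exact ⟨p, hp, by simpa [dist_eq_norm] using (Metric.mem_ball.1 hxp).le⟩
  choose N hNfin hN0 hN using hnet
  -- Steps between consecutive nets have size of order `4⁻ⁿ`. Rescaled by `2 ^ (n + 1)` they still
  -- tend to `0`, and each point of `K` is the sum of the rescaled steps with dyadic weights.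
  let E : ℕ → Set X := fun n => {d | ‖d‖ ≤ 4 * R * (1 / 2) ^ n ∧
    ∃ p ∈ N (n + 1), ∃ q ∈ N n, d = (2 : ℝ) ^ (n + 1) • (p - q)}
  have hEfin : ∀ n, (E n).Finite := fun n => by
    refine (((hNfin (n + 1)).prod (hNfin n)).image
      fun z : X × X => (2 : ℝ) ^ (n + 1) • (z.1 - z.2)).subset ?_
    rintro d ⟨-, p, hp, q, hq, rfl⟩
    exact ⟨(p, q), ⟨hp, hq⟩, rfl⟩
  refine ⟨⋃ n, E n, fun ε hε => ?_, fun C hC hCcl h0 hD x hx => ?_⟩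
  · have hlim : Tendsto (fun n : ℕ => 4 * R * (1 / 2 : ℝ) ^ n) atTop (𝓝 0) := by
      simpa using (tendsto_pow_atTop_nhds_zero_of_lt_one (r := (1 / 2 : ℝ)) (by norm_num)
        (by norm_num)).const_mul (4 * R)
    obtain ⟨n₀, hn₀⟩ := eventually_atTop.1 (hlim.eventually (gt_mem_nhds hε))
    refine ((finite_lt_nat n₀).biUnion fun n _ => hEfin n).subset ?_
    rintro d ⟨hd, hle⟩
    obtain ⟨n, hn⟩ := mem_iUnion.1 hd
    refine mem_iUnion₂.2 ⟨n, ?_, hn⟩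
    by_contra hlt
    exact (hle.trans hn.1).not_gt (hn₀ n (not_lt.1 hlt))
  · choose p hpN hp using fun n => hN n x hx
    have hp0 : p 0 = 0 := by simpa [hN0 0 rfl] using hpN 0
    have hd : ∀ n, (2 : ℝ) ^ (n + 1) • (p (n + 1) - p n) ∈ C := fun n => by
      refine hD (mem_iUnion.2 ⟨n, ?_, _, hpN _, _, hpN _, rfl⟩)
      have h1 : ‖p (n + 1) - p n‖ ≤ R * (1 / 4) ^ (n + 1) + R * (1 / 4) ^ n := by
        rw [show p (n + 1) - p n = (x - p n) - (x - p (n + 1)) by abel,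
          add_comm (R * _)]
        exact (norm_sub_le _ _).trans (add_le_add (hp n) (hp (n + 1)))
      have h2 : R * (1 / 4 : ℝ) ^ (n + 1) + R * (1 / 4) ^ n ≤ 2 * R * (1 / 4) ^ n := by
        have : 0 < R * (1 / 4 : ℝ) ^ n := by positivity
        rw [pow_succ]
        linarith
      have h3 : (1 / 4 : ℝ) ^ n = (1 / 2) ^ n * (1 / 2) ^ n := by
        rw [← mul_pow]
        norm_num
      have h4 : (2 : ℝ) ^ (n + 1) * (1 / 2) ^ n = 2 := by
        rw [pow_succ, mul_right_comm, ← mul_pow]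
        norm_num
      rw [norm_smul, Real.norm_of_nonneg (by positivity)]
      calc (2 : ℝ) ^ (n + 1) * ‖p (n + 1) - p n‖
          ≤ 2 ^ (n + 1) * (2 * R * (1 / 4) ^ n) := by gcongr; exact h1.trans h2
        _ = (2 ^ (n + 1) * (1 / 2) ^ n) * (2 * R * (1 / 2) ^ n) := by rw [h3]; ring
        _ = 4 * R * (1 / 2) ^ n := by rw [h4]; ring
    have hpC : ∀ M, p M ∈ C := fun M => by
      have h := hC.sum_dyadic_mem h0 M _ hd
      have hsum : ∑ n ∈ Finset.range M, (1 / 2 : ℝ) ^ (n + 1) • (2 : ℝ) ^ (n + 1) •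
          (p (n + 1) - p n) = p M := by
        rw [← sub_zero (p M), ← hp0, ← Finset.sum_range_sub]
        refine Finset.sum_congr rfl fun n _ => ?_
        rw [smul_smul, ← mul_pow]
        norm_num
      rwa [hsum] at h
    refine hCcl.mem_of_tendsto (f := p) (b := atTop) ?_ (Eventually.of_forall hpC)
    rw [tendsto_iff_norm_sub_tendsto_zero]
    refine squeeze_zero (fun _ => norm_nonneg _) (fun n => ?_)
      (show Tendsto (fun n : ℕ => R * (1 / 4 : ℝ) ^ n) atTop (𝓝 0) by
        simpa using (tendsto_pow_atTop_nhds_zero_of_lt_one (r := (1 / 4 : ℝ)) (by norm_num)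
          (by norm_num)).const_mul R)
    rw [norm_sub_rev]
    exact hp n

/-- A set with only finitely many elements outside each ball around `0` is contained in the range
of a null sequence of nonzero vectors together with `0`. -/
theorem exists_null_sequence [Nontrivial X] {D : Set X}
    (hD : ∀ ε : ℝ, 0 < ε → {d ∈ D | ε ≤ ‖d‖}.Finite) :
    ∃ e : ℕ → X, (∀ n, e n ≠ 0) ∧ Tendsto (fun n => ‖e n‖) atTop (𝓝 0) ∧
      D ⊆ insert 0 (range e) := by
  obtain ⟨v, hv⟩ := exists_ne (0 : X)
  -- Adjoining this injective null sequence makes the set infinite, so it can be enumerated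
  -- bijectively by `ℕ` even if `D` is finite; injectivity of the enumeration then forces it to tend
  -- to `0`.
  let F : ℕ → X := fun k => (1 / ((k : ℝ) + 1)) • v
  have hFne : ∀ k, F k ≠ 0 := fun k => smul_ne_zero (by positivity) hv
  have hFlim : Tendsto (fun k => ‖F k‖) atTop (𝓝 0) := by
    have h := (tendsto_one_div_add_atTop_nhds_zero_nat (𝕜 := ℝ)).smul_const v
    simpa [F] using h.norm
  have hFinj : Function.Injective F := fun j k h => by
    have h1 := smul_left_injective ℝ hv h
    simpa using h1
  set D' : Set X := D \ {0} ∪ range F with hD'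
  have hD'0 : ∀ d ∈ D', d ≠ 0 := by
    rintro d (hd | ⟨k, rfl⟩)
    · exact hd.2
    · exact hFne k
  have hD'fin : ∀ ε : ℝ, 0 < ε → {d ∈ D' | ε ≤ ‖d‖}.Finite := by
    intro ε hε
    obtain ⟨k₀, hk₀⟩ := eventually_atTop.1 (hFlim.eventually (gt_mem_nhds hε))
    refine ((hD ε hε).union ((finite_lt_nat k₀).image F)).subset ?_
    rintro d ⟨hd | ⟨k, rfl⟩, hle⟩
    · exact Or.inl ⟨hd.1, hle⟩
    · refine Or.inr ⟨k, ?_, rfl⟩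
      by_contra hlt
      exact hle.not_gt (hk₀ k (not_lt.1 hlt))
  have hcount : D'.Countable := by
    refine (countable_iUnion fun n : ℕ =>
      (hD'fin (1 / ((n : ℝ) + 1)) (by positivity)).countable).mono fun d hd => ?_
    obtain ⟨n, hn⟩ := exists_nat_one_div_lt (norm_pos_iff.2 (hD'0 d hd))
    exact mem_iUnion.2 ⟨n, hd, hn.le⟩
  have hinf : D'.Infinite := (infinite_range_of_injective hFinj).mono subset_union_right
  have := hcount.to_subtype
  have := hinf.to_subtype
  obtain ⟨e⟩ := nonempty_equiv_of_countable (α := ℕ) (β := D')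
  refine ⟨fun n => e n, fun n => hD'0 _ (e n).2, ?_, fun d hd => ?_⟩
  · rw [← Nat.cofinite_eq_atTop, Metric.tendsto_nhds]
    intro ε hε
    rw [eventually_cofinite]
    refine ((hD'fin ε hε).preimage
      ((Subtype.val_injective.comp e.injective).injOn (s := univ) |>.mono
        (subset_univ _))).subset fun n hn => ?_
    refine ⟨(e n).2, ?_⟩
    simpa using hn
  · by_cases hd0 : d = 0
    · exact Or.inl hd0
    · refine Or.inr ⟨e.symm ⟨d, Or.inl ⟨hd, hd0⟩⟩, ?_⟩
      simp

end NullSequence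

/-- A compact set witnessing the failure of the approximation property lies in a multiple `M` of the
hull of a null sequence; by homogeneity the failure passes to that hull with constant `ε / M`. -/
theorem nonempty_willisSequence {𝕜 X : Type*} [RCLike 𝕜] [NormedAddCommGroup X]
    [NormedSpace 𝕜 X] [NormedSpace ℝ X] [IsScalarTower ℝ 𝕜 X]
    (hX : ¬ HasApproximationProperty 𝕜 X) : Nonempty (WillisSequence 𝕜 X) := by
  unfold HasApproximationProperty at hX
  push Not at hX
  obtain ⟨K, hK, ε, hε, hbad⟩ := hX
  have : Nontrivial X := by
    obtain ⟨x, -, hx⟩ := hbad 0 (zero_mem _)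
    refine ⟨x, 0, ?_⟩
    rintro rfl
    simp at hx
    linarith
  obtain ⟨D, hD, hDK⟩ := hK.exists_null_set
  obtain ⟨e, he0, helim, heD⟩ := exists_null_sequence hD
  obtain ⟨M₀, hM₀⟩ := helim.bddAbove_range
  -- Dividing by `M` brings the sequence into the unit ball; the `1` guarantees `M > 0`.
  set M : ℝ := max M₀ 1 with hM
  have hM0 : 0 < M := lt_max_of_lt_right one_pos
  have hnorm : ∀ n, ‖M⁻¹ • e n‖ = M⁻¹ * ‖e n‖ := fun n => by
    rw [norm_smul, Real.norm_of_nonneg (by positivity)]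
  set x : ℕ → X := fun n => M⁻¹ • e n with hx
  have h0 : (0 : X) ∈ closedCircledHull 𝕜 x :=
    (balanced_closedCircledHull x).zero_mem ⟨_, mem_closedCircledHull x 0⟩
  have hKsub : K ⊆ M • closedCircledHull 𝕜 x := by
    refine hDK _ ((convex_closedCircledHull x).smul M)
      (isClosed_closure.smul_of_ne_zero hM0.ne') ⟨0, h0, smul_zero M⟩ fun d hd => ?_
    rcases heD hd with rfl | ⟨n, rfl⟩
    · exact ⟨0, h0, smul_zero M⟩
    · exact ⟨x n, mem_closedCircledHull x n, smul_inv_smul₀ hM0.ne' _⟩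
  refine ⟨⟨x, fun n => ?_, fun n => ?_, ?_, ε / M, by positivity, fun V hV => ?_⟩⟩
  · exact norm_pos_iff.2 (smul_ne_zero (by positivity) (he0 n))
  · rw [hx, hnorm, inv_mul_le_one₀ hM0]
    exact (hM₀ ⟨n, rfl⟩).trans (le_max_left _ _)
  · simp only [hx, hnorm]
    simpa using helim.const_mul M⁻¹
  · obtain ⟨y, hy, hlt⟩ := hbad V hV
    obtain ⟨z, hz, rfl⟩ := hKsub hy
    refine ⟨z, hz, ?_⟩
    change ε < ‖M • z - V (M • z)‖ at hlt
    rw [V.map_smul_of_tower, ← smul_sub, norm_smul, Real.norm_of_nonneg hM0.le] at hlt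
    rw [div_le_iff₀' hM0]
    exact hlt.le

theorem theorem3p3 {𝕜 X : Type*} [RCLike 𝕜] [NormedAddCommGroup X] [NormedSpace 𝕜 X]
    [NormedSpace ℝ X] [IsScalarTower ℝ 𝕜 X] [CompleteSpace X]
    (hX : ¬ HasApproximationProperty 𝕜 X) :
    Nonempty (WillisSequence 𝕜 X) ∧
    ∀ w : WillisSequence 𝕜 X,
      ∃ ψ : C₀(ℕ, 𝕜) →L[𝕜] CompactByApproximable 𝕜 w.Space,
        ∃ δ : ℝ, 0 < δ ∧ ∀ a : C₀(ℕ, 𝕜), δ * ‖a‖ ≤ ‖ψ a‖ :=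
  ⟨nonempty_willisSequence hX, fun w => w.exists_embedding⟩
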